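/- Let $q\ge 1$ and $p\ge 2q$ be integers, $G=SU(p+q)$ and $K_1=SU(p)\times SU(q)$, embedded block-diagonally in $G$, with normalized Haar measure $dk$. A spherical function of $(G,K_1)$ is a continuous function $\varphi:G\to\mathbb C$, $\varphi\not\equiv 0$, that is $K_1$-biinvariant and satisfies $\varphi(g)\varphi(h)=\int_{K_1}\varphi(gkh)\,dk$ for all $g,h\in G$. Notation. $\mathbb T=\{z\in\mathbb C:|z|=1\}$; $A_q=\{t\in\mathbb R^q:\ \pi/2\ge t_1\ge\dots\ge t_q\ge 0\}$; for $r\in\mathbb R^q$ and $z\in\mathbb T$ put $[r,z]=(zr_1,r_2,\dots,r_q)\in\mathbb C\times\mathbb R^{q-1}$, and let $X_q=\{[r,z]:\ z\in\mathbb T,\ 0\le r_1\le\dots\le r_q\le 1\}$. $\Delta$ is the determinant; $\sigma_{sing}(X)$ is the vector of singular values of $X\in M_q(\mathbb C)$ with multiplicities, arranged in increasing order; $\arg z=z/|z|$ for $z\ne 0$ and $\arg 0=1$; $\underline t=\mathrm{diag}(t_1,\dots,t_q)$, with $\cos\underline t$ and $\sin\underline t$ the diagonal matrices with entries $\cos t_j$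 and $\sin t_j$; $h(z)=\mathrm{diag}(z,1,\dots,1)\in M_q(\mathbb C)$; $D(g)$ is the lower right $q\times q$ block of $g\in G$. For $x=[\cos t,z]\in X_q$ with $t\in A_q$, $z\in\mathbb T$, let $$b_x=\begin{pmatrix} I_{p-q}&0&0\\ 0&h(z^{-1})\cos\underline t&-\sin\underline t\\ 0&\sin\underline t&h(z)\cos\underline t\end{pmatrix}\in G,$$ which depends only on $x$. Further let $B_q=\{w\in M_q(\mathbb C):\ w^*w\le I_q\}$, let $dw$ be Lebesgue measure on $M_q(\mathbb C)$ and $dv$ the normalized Haar measure on $SU(q)$, and let $\kappa_p=\int_{B_q}\Delta(I_q-w^*w)^{p-2q}\,dw$. Theorem. Let $\varphi$ be a spherical function of $(G,K_1)$, considered as a function on $X_q$ by $\varphi(x):=\varphi(b_x)$; then for every $g\in G$ the point $[\sigma_{sing}(D(g)),\arg\Delta(D(g))]$ lies in $X_q$ and $\varphi(g)=\varphi([\sigma_{sing}(D(g)),\arg\Delta(D(g))])$. For all $t,t'\in A_q$ and $z,z'\in\mathbb T$, with $M(w,v)=-\sin\underline t\,w\sin\underline t'+\cos\underline t\,v\cos\underline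 t'$, $$\varphi([\cos t,z])\,\varphi([\cos t',z'])=\frac1{\kappa_p}\int_{B_q}\int_{SU(q)}\varphi\bigl(\bigl[\sigma_{sing}(M(w,v)),\ zz'\cdot\arg\Delta(M(w,v))\bigr]\bigr)\,\Delta(I_q-w^*w)^{p-2q}\,dv\,dw .$$ Here the argument of $\varphi$ lies in $X_q$ for all $w\in B_q$, $v\in SU(q)$, and the integrand is integrable on $B_q\times SU(q)$. -/

import Mathlib

noncomputable section

open MeasureTheory Matrix

open scoped ComplexOrder

namespace ProductFormula

/-- The special unitary group of matrices indexed by `n`. -/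
abbrev SU (n : Type) [Fintype n] [DecidableEq n] : Type := Matrix.specialUnitaryGroup n ℂ

section Haar

variable {n : Type} [Fintype n] [DecidableEq n]

instance SU.instMeasurableSpace : MeasurableSpace (SU n) := borel _

instance SU.instBorelSpace : BorelSpace (SU n) := ⟨rfl⟩

instance SU.instIsTopologicalGroup : IsTopologicalGroup (SU n) where
  continuous_inv := by
    refine Continuous.subtype_mk (f := fun A : SU n => star (A : Matrix n n ℂ)) ?_ _
    exact continuous_star.comp continuous_subtype_val

instance SU.instCompactSpace : CompactSpace (SU n) := by
  have hsub : ((Matrix.specialUnitaryGroup n ℂ : Submonoid (Matrix n n ℂ)) : Set (Matrix n n ℂ)) ⊆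
      Set.pi Set.univ (fun _ : n => Set.pi Set.univ fun _ : n => Metric.closedBall (0 : ℂ) 1) := by
    intro A hA i _ j _
    simpa using entry_norm_bound_of_unitary hA.1 i j
  have hcl : IsClosed
      ((Matrix.specialUnitaryGroup n ℂ : Submonoid (Matrix n n ℂ)) : Set (Matrix n n ℂ)) := by
    have : ((Matrix.specialUnitaryGroup n ℂ : Submonoid (Matrix n n ℂ)) : Set (Matrix n n ℂ)) =
        {A | A * star A = 1} ∩ {A | A.det = 1} := by
      ext A
      simp [Matrix.mem_specialUnitaryGroup_iff, Matrix.mem_unitaryGroup_iff]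
    rw [this]
    exact (isClosed_eq (continuous_id.mul continuous_star) continuous_const).inter
      (isClosed_eq (Continuous.matrix_det continuous_id) continuous_const)
  have hK : IsCompact
      (Set.pi Set.univ (fun _ : n => Set.pi Set.univ fun _ : n => Metric.closedBall (0 : ℂ) 1)) :=
    isCompact_univ_pi fun _ => isCompact_univ_pi fun _ => isCompact_closedBall _ _
  exact isCompact_iff_compactSpace.mp (hK.of_isClosed_subset hcl hsub)

variable (n) in
/-- The normalized Haar measure on `SU(n)`. -/
def haarSU : Measure (SU n) := Measure.haarMeasure ⊤

end Haar

/-- The block diagonal embedding of `K₁ = SU(p) × SU(q)` into `G = SU(p+q)`. -/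
def embK (p q : ℕ) (k : SU (Fin p) × SU (Fin q)) : SU (Fin p ⊕ Fin q) :=
  ⟨Matrix.fromBlocks k.1.1 0 0 k.2.1, by
    have h1 := Matrix.mem_specialUnitaryGroup_iff.mp k.1.2
    have h2 := Matrix.mem_specialUnitaryGroup_iff.mp k.2.2
    rw [Matrix.mem_unitaryGroup_iff] at h1 h2
    rw [Matrix.mem_specialUnitaryGroup_iff, Matrix.mem_unitaryGroup_iff]
    constructor
    · rw [Matrix.star_eq_conjTranspose, Matrix.fromBlocks_conjTranspose,
        Matrix.fromBlocks_multiply]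
      simp [← Matrix.star_eq_conjTranspose, h1.1, h2.1]
    · simp [h1.2, h2.2]⟩

/-- `φ` is a spherical function of `(SU(p+q), SU(p) × SU(q))`. The measure in the product formula
is the normalized Haar measure of `SU(p) × SU(q)`. -/
structure IsSpherical (p q : ℕ) (φ : SU (Fin p ⊕ Fin q) → ℂ) : Prop where
  continuous : Continuous φ
  biinvariant : ∀ k l : SU (Fin p) × SU (Fin q), ∀ g, φ (embK p q k * g * embK p q l) = φ g
  ne_zero : φ ≠ 0
  mul_eq : ∀ g h, φ g * φ h =
    ∫ k, φ (g * embK p q k * h) ∂((haarSU (Fin p)).prod (haarSU (Fin q)))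

/-- The alcove `A_q`. -/
def alcove (q : ℕ) : Set (Fin q → ℝ) :=
  {t | Antitone t ∧ ∀ i, 0 ≤ t i ∧ t i ≤ Real.pi / 2}

/-- `arg z = z / |z|` for `z ≠ 0` and `arg 0 = 1`; see `coe_argT`. -/
def argT (z : ℂ) : Circle := Circle.exp (Complex.arg z)

theorem coe_argT (z : ℂ) : (argT z : ℂ) = if z = 0 then 1 else z / (‖z‖ : ℂ) := by
  by_cases h : z = 0
  · simp [argT, h]
  · have hn : (‖z‖ : ℂ) ≠ 0 := by simpa using h
    rw [if_neg h, argT, Circle.coe_exp, eq_div_iff hn, mul_comm, Complex.norm_mul_exp_arg_mul_I]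

section Cone

variable {q : ℕ} [NeZero q]

/-- The point `[r, z] = (z r₁, r₂, …, r_q)` of `ℂ × ℝ^(q-1)`. -/
def bracket (r : Fin q → ℝ) (z : Circle) : ℂ × (Fin (q - 1) → ℝ) :=
  ((z : ℂ) * (r 0 : ℂ), fun i => r ⟨i + 1, by omega⟩)

variable (q) in
/-- The cone `X_q`. -/
def cone : Set (ℂ × (Fin (q - 1) → ℝ)) :=
  {x | ∃ (r : Fin q → ℝ) (z : Circle), Monotone r ∧ (∀ i, 0 ≤ r i ∧ r i ≤ 1) ∧ x = bracket r z}

/-- The vector `r` with `x = [r, z]`, for `x` in the cone. -/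
def radial (x : ℂ × (Fin (q - 1) → ℝ)) (i : Fin q) : ℝ :=
  if h : (i : ℕ) = 0 then ‖x.1‖ else x.2 ⟨i - 1, by omega⟩

/-- `h(z) = diag(z, 1, …, 1)`. -/
def hDiag (z : ℂ) : Matrix (Fin q) (Fin q) ℂ := Matrix.diagonal fun i => if i = 0 then z else 1

end Cone

/-- The diagonal matrix `cos t`. -/
def cosD {q : ℕ} (t : Fin q → ℝ) : Matrix (Fin q) (Fin q) ℂ :=
  Matrix.diagonal fun i => (Real.cos (t i) : ℂ)

/-- The diagonal matrix `sin t`. -/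
def sinD {q : ℕ} (t : Fin q → ℝ) : Matrix (Fin q) (Fin q) ℂ :=
  Matrix.diagonal fun i => (Real.sin (t i) : ℂ)

/-- The singular values of `X` (with multiplicity), in increasing order. -/
def sing {q : ℕ} (X : Matrix (Fin q) (Fin q) ℂ) (i : Fin q) : ℝ :=
  (Matrix.toEuclideanLin X).singularValues (Fin.rev i : ℕ)

/-- The order preserving identification of the index set of `(p-q) + q + q` blocks with that of
`p + q` blocks. -/
def blockEquiv {p q : ℕ} (hqp : q ≤ p) : Fin (p - q) ⊕ (Fin q ⊕ Fin q) ≃ Fin p ⊕ Fin q :=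
  (Equiv.sumAssoc _ _ _).symm.trans
    (Equiv.sumCongr (finSumFinEquiv.trans (finCongr (Nat.sub_add_cancel hqp))) (Equiv.refl _))

theorem le_of_two_mul_le {p q : ℕ} (h : 2 * q ≤ p) : q ≤ p := by omega

theorem det_fromBlocks_diagonal {q : ℕ} (a b c d : Fin q → ℂ) :
    (Matrix.fromBlocks (Matrix.diagonal a) (Matrix.diagonal b) (Matrix.diagonal c)
      (Matrix.diagonal d)).det = ∏ i, (a i * d i - b i * c i) := by
  let e : Fin 2 × Fin q ≃ Fin q ⊕ Fin q :=
    (Equiv.prodCongr finTwoEquiv (Equiv.refl _)).trans (Equiv.boolProdEquivSum _)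
  have : (Matrix.fromBlocks (Matrix.diagonal a) (Matrix.diagonal b) (Matrix.diagonal c)
      (Matrix.diagonal d)).submatrix e e =
      Matrix.blockDiagonal fun i => !![a i, b i; c i, d i] := by
    ext ⟨x, i⟩ ⟨y, j⟩
    fin_cases x <;> fin_cases y <;>
      simp [e, Equiv.boolProdEquivSum, finTwoEquiv, Matrix.blockDiagonal_apply,
        Matrix.diagonal_apply]
  rw [← Matrix.det_submatrix_equiv_self e, this, Matrix.det_blockDiagonal]
  simp [Matrix.det_fin_two]

section Representatives

variable {p q : ℕ} [NeZero q]

/-- The lower right `2q × 2q` part of the double coset representatives. -/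
def rotBlock (t : Fin q → ℝ) (z : Circle) : Matrix (Fin q ⊕ Fin q) (Fin q ⊕ Fin q) ℂ :=
  Matrix.fromBlocks (hDiag ((z⁻¹ : Circle) : ℂ) * cosD t) (-sinD t) (sinD t)
    (hDiag (z : ℂ) * cosD t)

theorem rotBlock_det (t : Fin q → ℝ) (z : Circle) : (rotBlock t z).det = 1 := by
  have : rotBlock t z = Matrix.fromBlocks
      (Matrix.diagonal fun i => (if i = 0 then ((z⁻¹ : Circle) : ℂ) else 1) * (Real.cos (t i) : ℂ))
      (Matrix.diagonal fun i => -(Real.sin (t i) : ℂ))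
      (Matrix.diagonal fun i => (Real.sin (t i) : ℂ))
      (Matrix.diagonal fun i => (if i = 0 then (z : ℂ) else 1) * (Real.cos (t i) : ℂ)) := by
    simp [rotBlock, hDiag, cosD, sinD, Matrix.diagonal_mul_diagonal, Matrix.diagonal_neg]
  rw [this, det_fromBlocks_diagonal]
  refine Finset.prod_eq_one fun i _ => ?_
  have hcs : (Real.cos (t i) : ℂ) * Real.cos (t i) + Real.sin (t i) * Real.sin (t i) = 1 := by
    have := Real.cos_sq_add_sin_sq (t i)
    exact_mod_cast (by nlinarith : Real.cos (t i) * Real.cos (t i) +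
      Real.sin (t i) * Real.sin (t i) = 1)
  have hz : ((z⁻¹ : Circle) : ℂ) * (z : ℂ) = 1 := by
    rw [← Circle.coe_mul]; simp
  split_ifs
  · linear_combination hcs + (Real.cos (t i) : ℂ) * Real.cos (t i) * hz
  · linear_combination hcs

theorem rotBlock_unitary (t : Fin q → ℝ) (z : Circle) : rotBlock t z * (rotBlock t z)ᴴ = 1 := by
  have hz : ((z⁻¹ : Circle) : ℂ) * (z : ℂ) = 1 := by
    rw [← Circle.coe_mul]; simp
  have hz' : star (z : ℂ) = ((z⁻¹ : Circle) : ℂ) := (Circle.coe_inv_eq_conj z).symm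
  have hz'' : star ((z⁻¹ : Circle) : ℂ) = (z : ℂ) := by rw [← hz', star_star]
  have hcs : ∀ i, (Real.cos (t i) : ℂ) * Real.cos (t i) + Real.sin (t i) * Real.sin (t i) = 1 := by
    intro i
    have := Real.cos_sq_add_sin_sq (t i)
    exact_mod_cast (by nlinarith : Real.cos (t i) * Real.cos (t i) +
      Real.sin (t i) * Real.sin (t i) = 1)
  have hc : ∀ i, star (Real.cos (t i) : ℂ) = Real.cos (t i) := fun i => Complex.conj_ofReal _
  have hs : ∀ i, star (Real.sin (t i) : ℂ) = Real.sin (t i) := fun i => Complex.conj_ofReal _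
  rw [rotBlock, Matrix.fromBlocks_conjTranspose, Matrix.fromBlocks_multiply,
    ← Matrix.fromBlocks_one]
  simp only [hDiag, cosD, sinD, Matrix.diagonal_mul_diagonal, Matrix.diagonal_neg,
    Matrix.diagonal_conjTranspose, Matrix.diagonal_add]
  rw [← Matrix.diagonal_one, ← Matrix.diagonal_zero]
  congr 2 <;> funext i <;>
    simp only [Pi.star_apply, star_mul', star_neg, hc, hs, apply_ite star, hz', hz'',
      star_one]
  · split_ifs
    · linear_combination hcs i + (Real.cos (t i) : ℂ) * Real.cos (t i) * hz
    · linear_combination hcs i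
  · split_ifs <;> ring
  · split_ifs <;> ring
  · split_ifs
    · linear_combination hcs i + (Real.cos (t i) : ℂ) * Real.cos (t i) * hz
    · linear_combination hcs i

/-- The double coset representative
`[[I, 0, 0], [0, h(z⁻¹) cos t, - sin t], [0, sin t, h(z) cos t]]` in `SU(p+q)`. -/
def rep (hqp : q ≤ p) (t : Fin q → ℝ) (z : Circle) : SU (Fin p ⊕ Fin q) :=
  ⟨Matrix.reindex (blockEquiv hqp) (blockEquiv hqp) (Matrix.fromBlocks 1 0 0 (rotBlock t z)), by
    rw [Matrix.mem_specialUnitaryGroup_iff, Matrix.mem_unitaryGroup_iff]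
    constructor
    · rw [Matrix.star_eq_conjTranspose, Matrix.conjTranspose_reindex, Matrix.reindex_apply,
        Matrix.reindex_apply, Matrix.submatrix_mul_equiv, Matrix.fromBlocks_conjTranspose,
        Matrix.fromBlocks_multiply]
      simp [rotBlock_unitary]
    · rw [Matrix.det_reindex_self]
      simp [rotBlock_det]⟩

/-- A function `φ` on `SU(p+q)`, considered as a function on the cone: `x ↦ φ (b_x)`, where
`b_x` is the representative with parameters `t = arccos r` and `z` for `x = [r, z]`
(and `z = 1` if `r₁ = 0`). -/
def onCone (hqp : q ≤ p) (φ : SU (Fin p ⊕ Fin q) → ℂ) (x : ℂ × (Fin (q - 1) → ℝ)) : ℂ :=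
  φ (rep hqp (fun i => Real.arccos (radial x i)) (argT x.1))

/-- The cone parameter of the double coset of `g`, read off from the lower right `q × q` block
`D(g)` of `g`. -/
def coneCoord (g : SU (Fin p ⊕ Fin q)) : ℂ × (Fin (q - 1) → ℝ) :=
  bracket (sing (g : Matrix (Fin p ⊕ Fin q) (Fin p ⊕ Fin q) ℂ).toBlocks₂₂)
    (argT (g : Matrix (Fin p ⊕ Fin q) (Fin p ⊕ Fin q) ℂ).toBlocks₂₂.det)

end Representatives

/-- The matrix ball `B_q = {w : w* w ≤ I}`. -/
def matrixBall (q : ℕ) : Set (Fin q → Fin q → ℂ) :=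
  {w | (1 - (Matrix.of w)ᴴ * Matrix.of w).PosSemidef}

/-- The weight `Δ(I - w* w)^(p - 2q)`. -/
def weight (p q : ℕ) (w : Fin q → Fin q → ℂ) : ℂ :=
  (1 - (Matrix.of w)ᴴ * Matrix.of w).det ^ (p - 2 * q)

/-- The normalization constant `κ_p`; `volume` is Lebesgue measure on the complex `q × q`
matrices. -/
def kappa (p q : ℕ) : ℂ := ∫ w in matrixBall q, weight p q w

/-- The matrix `- sin t · w · sin t' + cos t · v · cos t'`. -/
def mixed {q : ℕ} (t t' : Fin q → ℝ) (w : Fin q → Fin q → ℂ) (v : SU (Fin q)) :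
    Matrix (Fin q) (Fin q) ℂ :=
  -sinD t * Matrix.of w * sinD t' + cosD t * (v : Matrix (Fin q) (Fin q) ℂ) * cosD t'

/-- The point `[σ_sing(M), z z' arg Δ(M)]` for `M = - sin t · w · sin t' + cos t · v · cos t'`. -/
def prodPoint {q : ℕ} [NeZero q] (t t' : Fin q → ℝ) (z z' : Circle) (w : Fin q → Fin q → ℂ)
    (v : SU (Fin q)) : ℂ × (Fin (q - 1) → ℝ) :=
  bracket (sing (mixed t t' w v)) (z * z' * argT (mixed t t' w v).det)

end ProductFormula

end

noncomputable section

open MeasureTheory Matrix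

open scoped ComplexOrder ENNReal Pointwise

namespace ProductFormula

/-! The double coset of `g` is determined by its lower right block `D(g)`. The upper right block has
Gram matrix `1 - D(g)ᴴ D(g)`, and two matrices with equal Gram matrices differ by a unitary left
factor, which can be given determinant one because `q < p` leaves a direction orthogonal to the
columns (`exists_embK_of_toBlocks₂₂_eq`). A singular value decomposition with factors in `SU(q)`
then brings `D(g)` to the form `h(z) diag(σ)`. Here `z` is the phase of the determinant, and it is
irrelevant when the smallest singular value vanishes. So `φ` depends only on the cone point of
`D(g)` (`IsSpherical.eq_onCone_matCoord`).

In the functional equation, the block `D` of `b_x k b_y`, for `k = (k₁, k₂)`, equals `h(z z') M(w,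
v)`. Up to `h` factors, `w` is the last `q × q` corner of `k₁` and `v` is `k₂`, and these factors
preserve the measures involved. What remains is the law of the corner of a Haar distributed `k₁`,
which must be proportional to `Δ(1 - wᴴ w)^(p - 2q) dw`.

That law is proved for `U(P)` by induction on the number of rows of the corner
(`lintegral_corner_haarU`). The first row of a Haar unitary is uniform on the sphere, so some of its
entries have a density that is a power of `1 - |w|²`. Given that row `w`, the rows below are those
of a corner of a Haar element of `U(P - 1)`, multiplied by the square root of `1 - w* w`. The
Jacobian of this multiplication turns the product of the two densities into the density one row
higher. The result passes to `SU(p)` because the determinant can be corrected in a column outside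
the corner.

The proportionality constants are never computed: comparing total masses forces the final one to be
`1 / κ_p`. -/

theorem star_det_mul_det_of_mem_unitaryGroup {n : Type*} [Fintype n] [DecidableEq n]
    {u : Matrix n n ℂ} (hu : u ∈ Matrix.unitaryGroup n ℂ) : star u.det * u.det = 1 := by
  have := congrArg Matrix.det (Matrix.mem_unitaryGroup_iff'.mp hu)
  rwa [Matrix.star_eq_conjTranspose, Matrix.det_mul, Matrix.det_conjTranspose,
    Matrix.det_one] at this

/-! ### Matrices with equal Gram matrices -/

section Gram

variable {ι κ : Type*} [Fintype ι] [DecidableEq ι] [Fintype κ] [DecidableEq κ]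

/-- Two matrices with the same Gram matrix differ by a unitary factor on the left. -/
theorem exists_unitary_of_gram_eq {X Y : Matrix ι κ ℂ} (h : Xᴴ * X = Yᴴ * Y) :
    ∃ u ∈ Matrix.unitaryGroup ι ℂ, Y = u * X := by
  let V := EuclideanSpace ℂ ι
  let W := EuclideanSpace ℂ κ
  let S : W →ₗ[ℂ] V := Matrix.toEuclideanLin X
  let T : W →ₗ[ℂ] V := Matrix.toEuclideanLin Y
  have hn : ∀ a, ‖S a‖ = ‖T a‖ := by
    have key : ∀ (Z : Matrix ι κ ℂ) (a : W), inner ℂ (Matrix.toEuclideanLin Z a)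
        (Matrix.toEuclideanLin Z a) = inner ℂ a (Matrix.toEuclideanLin (Zᴴ * Z) a) := by
      intro Z a
      rw [← LinearMap.adjoint_inner_right, ← Matrix.toEuclideanLin_conjTranspose_eq_adjoint]
      congr 1
      ext i
      simp [Matrix.mulVec_mulVec]
    intro a
    have := (key X a).trans ((congrArg (fun M => inner ℂ a (Matrix.toEuclideanLin M a)) h).trans
      (key Y a).symm)
    rw [inner_self_eq_norm_sq_to_K, inner_self_eq_norm_sq_to_K] at this
    have h2 : ‖S a‖ ^ 2 = ‖T a‖ ^ 2 := by exact_mod_cast this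
    exact (sq_eq_sq₀ (norm_nonneg _) (norm_nonneg _)).mp h2
  -- By equality of norms, `S a ↦ T a` is a well defined isometry on the range of `S`. The section
  -- `g` chooses preimages, and the isometry extends to the whole finite-dimensional space.
  obtain ⟨g, hg⟩ := S.rangeRestrict.exists_rightInverse_of_surjective S.range_rangeRestrict
  have hg' : ∀ b : S.range, S (g b) = b := fun b =>
    congrArg Subtype.val (LinearMap.congr_fun hg b)
  let L : S.range →ₗᵢ[ℂ] V :=
    { toLinearMap := T ∘ₗ g
      norm_map' := fun b => by
        change ‖T (g b)‖ = ‖b‖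
        rw [← hn, hg']; rfl }
  have hL : ∀ a, L.extend (S a) = T a := by
    intro a
    have h1 := L.extend_apply ⟨S a, LinearMap.mem_range_self S a⟩
    refine h1.trans ?_
    change T (g _) = T a
    have : ‖T (g ⟨S a, LinearMap.mem_range_self S a⟩ - a)‖ = 0 := by
      rw [← hn, map_sub, hg', sub_self, norm_zero]
    rw [norm_eq_zero, map_sub, sub_eq_zero] at this
    exact this
  let U : Matrix ι ι ℂ := Matrix.toEuclideanLin.symm L.extend.toLinearMap
  have hU : Matrix.toEuclideanLin U = L.extend.toLinearMap := LinearEquiv.apply_symm_apply _ _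
  refine ⟨U, ?_, ?_⟩
  · rw [Matrix.mem_unitaryGroup_iff', Matrix.star_eq_conjTranspose]
    apply Matrix.toEuclideanLin.injective
    ext1 x
    refine ext_inner_left ℂ fun y => ?_
    have h1 : Matrix.toEuclideanLin (Uᴴ * U) x =
        Matrix.toEuclideanLin Uᴴ (Matrix.toEuclideanLin U x) := by
      ext i; simp [Matrix.mulVec_mulVec]
    rw [h1, Matrix.toEuclideanLin_conjTranspose_eq_adjoint, LinearMap.adjoint_inner_right, hU]
    have h2 : Matrix.toEuclideanLin (1 : Matrix ι ι ℂ) x = x := by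
      ext i; simp
    rw [h2]
    exact L.extend.inner_map_map y x
  · apply Matrix.toEuclideanLin.injective
    ext1 x
    have h1 : Matrix.toEuclideanLin (U * X) x =
        Matrix.toEuclideanLin U (Matrix.toEuclideanLin X x) := by
      ext i; simp [Matrix.toLpLin_apply, Matrix.mulVec_mulVec]
    rw [h1, hU]
    exact (hL x).symm

/-- If the matrices have fewer columns than rows, the unitary factor can be chosen with
determinant one. -/
theorem exists_specialUnitary_of_gram_eq (hcard : Fintype.card κ < Fintype.card ι)
    {X Y : Matrix ι κ ℂ} (h : Xᴴ * X = Yᴴ * Y) :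
    ∃ u ∈ Matrix.specialUnitaryGroup ι ℂ, Y = u * X := by
  obtain ⟨u, hu, rfl⟩ := exists_unitary_of_gram_eq h
  -- A nonzero vector orthogonal to all columns of `X`; the determinant of `u` will be corrected
  -- along it.
  obtain ⟨v, hv, hv0⟩ : ∃ v : ι → ℂ, Xᴴ *ᵥ v = 0 ∧ v ≠ 0 := by
    have := LinearMap.ker_ne_bot_of_finrank_lt (f := Matrix.mulVecLin Xᴴ) (by simpa using hcard)
    obtain ⟨v, hv, hv0⟩ := (Submodule.ne_bot_iff _).mp this
    exact ⟨v, by simpa using hv, hv0⟩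
  have hN : star v ⬝ᵥ v ≠ 0 := by simpa using hv0
  have hl := star_det_mul_det_of_mem_unitaryGroup hu
  have hNs : star (star v ⬝ᵥ v) = star v ⬝ᵥ v := by
    exact (Matrix.star_dotProduct v v).symm
  set N := star v ⬝ᵥ v with hNdef
  -- Chosen so that `R = 1 + a v v*` multiplies `v` by `1 + a N = star u.det` and fixes the
  -- orthogonal complement of `v`, hence `X`.
  set a : ℂ := (star u.det - 1) / N with ha
  have has : star a = (u.det - 1) / N := by
    rw [ha, star_div₀, hNs, star_sub, star_star, star_one]
  let R : Matrix ι ι ℂ := 1 + a • Matrix.vecMulVec v (star v)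
  have hRX : R * X = X := by
    have : Matrix.vecMulVec v (star v) * X = 0 := by
      rw [Matrix.vecMulVec_mul]
      have : star v ᵥ* X = 0 := by
        rw [← star_star (star v ᵥ* X), Matrix.star_vecMul, star_star, hv, star_zero]
      rw [this]
      ext; simp [Matrix.vecMulVec_apply]
    rw [Matrix.add_mul, Matrix.one_mul, Matrix.smul_mul, this, smul_zero, add_zero]
  have hPP : Matrix.vecMulVec v (star v) * Matrix.vecMulVec v (star v) =
      N • Matrix.vecMulVec v (star v) := by
    rw [Matrix.vecMulVec_mul_vecMulVec, ← hNdef, Matrix.vecMulVec_smul]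
  have hPs : (Matrix.vecMulVec v (star v))ᴴ = Matrix.vecMulVec v (star v) := by
    rw [Matrix.conjTranspose_vecMulVec, star_star]
  have hRu : R ∈ Matrix.unitaryGroup ι ℂ := by
    rw [Matrix.mem_unitaryGroup_iff', Matrix.star_eq_conjTranspose]
    simp only [R, Matrix.conjTranspose_add, Matrix.conjTranspose_one, Matrix.conjTranspose_smul,
      hPs, add_mul, mul_add, one_mul, mul_one, Matrix.smul_mul, Matrix.mul_smul, hPP, smul_smul]
    rw [add_assoc, ← add_smul, ← add_smul, has, ha]
    convert add_zero _
    rw [smul_eq_zero]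
    left
    field_simp
    linear_combination hl
  have hRd : R.det = star u.det := by
    have : R = 1 + Matrix.replicateCol Unit (a • v) * Matrix.replicateRow Unit (star v) := by
      ext i j
      simp [R, Matrix.vecMulVec_apply, Matrix.mul_apply]
    rw [this, Matrix.det_one_add_replicateCol_mul_replicateRow, dotProduct_smul, ← hNdef, ha,
      smul_eq_mul, div_mul_cancel₀ _ hN]
    ring
  refine ⟨u * R, ?_, by rw [Matrix.mul_assoc, hRX]⟩
  rw [Matrix.mem_specialUnitaryGroup_iff]
  exact ⟨mul_mem hu hRu, by rw [Matrix.det_mul, hRd, mul_comm, hl]⟩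

end Gram

/-! ### Singular values and decompositions with determinant-one factors -/

section SingularValues

variable {q : ℕ}

theorem sing_nonneg (X : Matrix (Fin q) (Fin q) ℂ) (i : Fin q) : 0 ≤ sing X i :=
  LinearMap.singularValues_nonneg _ _

theorem sing_monotone (X : Matrix (Fin q) (Fin q) ℂ) : Monotone (sing X) := fun _ _ h =>
  LinearMap.singularValues_antitone _ (Fin.rev_le_rev.mpr h)

theorem sing_congr {X Y : Matrix (Fin q) (Fin q) ℂ} (h : Xᴴ * X = Yᴴ * Y) : sing X = sing Y := by
  have key : ∀ Z : Matrix (Fin q) (Fin q) ℂ, LinearMap.adjoint (Matrix.toEuclideanLin Z) ∘ₗ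
      Matrix.toEuclideanLin Z = Matrix.toEuclideanLin (Zᴴ * Z) := by
    intro Z
    rw [← Matrix.toEuclideanLin_conjTranspose_eq_adjoint]
    ext x i
    simp [Matrix.mulVec_mulVec]
  funext i
  have hn : Module.finrank ℂ (EuclideanSpace ℂ (Fin q)) = q := by simp
  have hK := (key X).trans ((congrArg _ h).trans (key Y).symm)
  unfold sing
  rw [LinearMap.singularValues_fin _ hn, LinearMap.singularValues_fin _ hn]
  simp only [hK]

/-- Singular value decomposition. -/
theorem exists_svd (X : Matrix (Fin q) (Fin q) ℂ) :
    ∃ u ∈ Matrix.unitaryGroup (Fin q) ℂ, ∃ v ∈ Matrix.unitaryGroup (Fin q) ℂ,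
      X = u * Matrix.diagonal (fun i => (sing X i : ℂ)) * v := by
  have hn : Module.finrank ℂ (EuclideanSpace ℂ (Fin q)) = q := by simp
  let T := Matrix.toEuclideanLin X
  let b := T.isSymmetric_adjoint_comp_self.eigenvectorBasis hn
  -- The columns are eigenvectors of `Xᴴ X`, reversed to match the increasing order of `sing`. The
  -- columns of `X V` are then orthogonal with lengths `sing X i`, so `X V` has the Gram matrix of
  -- the diagonal matrix.
  let V : Matrix (Fin q) (Fin q) ℂ := Matrix.of fun j i => b i.rev j
  have hcol : ∀ (Z : Matrix (Fin q) (Fin q) ℂ) i j, ((Z * V)ᴴ * (Z * V)) i j =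
      inner ℂ (Matrix.toEuclideanLin Z (b i.rev)) (Matrix.toEuclideanLin Z (b j.rev)) := by
    intro Z i j
    have h1 : ∀ i k, Matrix.toEuclideanLin Z (b i.rev) k = (Z * V) k i := fun _ _ => rfl
    rw [Matrix.mul_apply, PiLp.inner_apply]
    refine Finset.sum_congr rfl fun k _ => ?_
    rw [h1, h1, Matrix.conjTranspose_apply, RCLike.inner_apply, mul_comm]
    rfl
  have hV : Vᴴ * V = 1 := by
    ext i j
    have := hcol 1 i j
    rw [one_mul] at this
    rw [this]
    have h1 : ∀ x, Matrix.toEuclideanLin (1 : Matrix (Fin q) (Fin q) ℂ) x = x := by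
      intro x; ext i; simp
    rw [h1, h1, orthonormal_iff_ite.mp b.orthonormal, Matrix.one_apply]
    simp [Fin.rev_inj]
  have hS : (Matrix.diagonal (fun i => (sing X i : ℂ)))ᴴ *
      Matrix.diagonal (fun i => (sing X i : ℂ)) = (X * V)ᴴ * (X * V) := by
    ext i j
    rw [hcol, ← LinearMap.adjoint_inner_right]
    have h1 := T.isSymmetric_adjoint_comp_self.apply_eigenvectorBasis hn j.rev
    rw [LinearMap.comp_apply] at h1
    change _ = inner ℂ (b i.rev) (LinearMap.adjoint T (T (b j.rev)))
    change LinearMap.adjoint T (T (b j.rev)) = _ at h1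
    rw [h1, inner_smul_right, ← T.sq_singularValues_fin hn, Matrix.diagonal_conjTranspose,
      Matrix.diagonal_mul_diagonal, Matrix.diagonal_apply]
    change _ = _ * inner ℂ (b i.rev) (b j.rev)
    rw [orthonormal_iff_ite.mp b.orthonormal]
    by_cases hij : i = j
    · subst hij
      simp [sing, T, sq]
    · simp [hij, Fin.rev_inj]
  obtain ⟨u, hu, hXV⟩ := exists_unitary_of_gram_eq hS
  have hVu : V ∈ Matrix.unitaryGroup (Fin q) ℂ := by
    rw [Matrix.mem_unitaryGroup_iff', Matrix.star_eq_conjTranspose, hV]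
  refine ⟨u, hu, star V, Unitary.star_mem hVu, ?_⟩
  rw [← hXV, Matrix.mul_assoc, Matrix.mem_unitaryGroup_iff.mp hVu, mul_one]

variable [NeZero q]

theorem hDiag_mul (z w : ℂ) : (hDiag z : Matrix (Fin q) (Fin q) ℂ) * hDiag w = hDiag (z * w) := by
  rw [hDiag, hDiag, Matrix.diagonal_mul_diagonal, hDiag]
  congr 1
  funext i
  split_ifs <;> simp

theorem hDiag_one : (hDiag 1 : Matrix (Fin q) (Fin q) ℂ) = 1 := by
  rw [hDiag, ← Matrix.diagonal_one]; congr 1; funext i; simp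

theorem det_hDiag (z : ℂ) : (hDiag z : Matrix (Fin q) (Fin q) ℂ).det = z := by
  simp [hDiag]

theorem hDiag_conjTranspose (z : ℂ) :
    (hDiag z : Matrix (Fin q) (Fin q) ℂ)ᴴ = hDiag (star z) := by
  rw [hDiag, hDiag, Matrix.diagonal_conjTranspose]
  congr 1
  funext i
  simp only [Pi.star_apply]
  split_ifs <;> simp

theorem hDiag_mem_unitaryGroup {z : ℂ} (hz : star z * z = 1) :
    (hDiag z : Matrix (Fin q) (Fin q) ℂ) ∈ Matrix.unitaryGroup (Fin q) ℂ := by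
  rw [Matrix.mem_unitaryGroup_iff', Matrix.star_eq_conjTranspose, hDiag_conjTranspose,
    hDiag_mul, hz, hDiag_one]

theorem hDiag_comm_diagonal (z : ℂ) (d : Fin q → ℂ) :
    hDiag z * Matrix.diagonal d = Matrix.diagonal d * hDiag z := by
  simp [hDiag, Matrix.diagonal_mul_diagonal, mul_comm]

theorem argT_mul_ofReal_of_pos {z : ℂ} (hz : star z * z = 1) {r : ℝ} (hr : 0 < r) :
    (argT (z * r) : ℂ) = z := by
  have hz1 : ‖z‖ = 1 := by
    have h2 := congrArg norm hz
    rw [norm_mul, norm_star, norm_one] at h2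
    nlinarith [norm_nonneg z]
  have hz0 : z ≠ 0 := by rintro rfl; simp at hz
  rw [coe_argT, if_neg (mul_ne_zero hz0 (by exact_mod_cast hr.ne')), norm_mul, hz1,
    Complex.norm_of_nonneg hr.le, one_mul, mul_div_cancel_right₀]
  exact_mod_cast hr.ne'

/-- Singular value decomposition with factors of determinant one. -/
theorem exists_special_svd (X : Matrix (Fin q) (Fin q) ℂ) :
    ∃ u v : SU (Fin q), X = u.1 * (hDiag (argT X.det : ℂ) *
      Matrix.diagonal (fun i => (sing X i : ℂ))) * v.1 := by
  obtain ⟨u, hu, v, hv, hX⟩ := exists_svd X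
  have hdu := star_det_mul_det_of_mem_unitaryGroup hu
  have hdv := star_det_mul_det_of_mem_unitaryGroup hv
  have hsu : star (star u.det) * star u.det = 1 := by rw [star_star, mul_comm, hdu]
  have hsv : star (star v.det) * star v.det = 1 := by rw [star_star, mul_comm, hdv]
  refine ⟨⟨u * hDiag (star u.det), ?_⟩, ⟨hDiag (star v.det) * v, ?_⟩, ?_⟩
  · rw [Matrix.mem_specialUnitaryGroup_iff]
    exact ⟨mul_mem hu (hDiag_mem_unitaryGroup hsu), by
      rw [Matrix.det_mul, det_hDiag, mul_comm, hdu]⟩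
  · rw [Matrix.mem_specialUnitaryGroup_iff]
    exact ⟨mul_mem (hDiag_mem_unitaryGroup hsv) hv, by rw [Matrix.det_mul, det_hDiag, hdv]⟩
  · set S : Matrix (Fin q) (Fin q) ℂ := Matrix.diagonal (fun i => (sing X i : ℂ)) with hS
    -- If `det X ≠ 0`, its phase is `det u · det v`. Otherwise the smallest singular value vanishes;
    -- it sits at index `0`, the only entry on which `h` acts, so the phase does not matter.
    have hmid : hDiag (argT X.det : ℂ) * S = hDiag (u.det * v.det) * S := by
      have hdet : X.det = u.det * v.det * ((∏ i, sing X i : ℝ) : ℂ) := by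
        conv_lhs => rw [hX]
        rw [Matrix.det_mul, Matrix.det_mul, hS, Matrix.det_diagonal]
        push_cast
        ring
      rcases (Finset.prod_nonneg fun i (_ : i ∈ Finset.univ) => sing_nonneg X i).lt_or_eq with h | h
      · rw [hdet, argT_mul_ofReal_of_pos _ h]
        rw [star_mul']
        linear_combination (star v.det * v.det) * hdu + hdv
      · obtain ⟨i, -, hi⟩ := Finset.prod_eq_zero_iff.mp h.symm
        have h0 : sing X 0 = 0 :=
          le_antisymm ((sing_monotone X (Fin.zero_le i)).trans hi.le) (sing_nonneg X 0)
        rw [hDiag, hDiag, hS, Matrix.diagonal_mul_diagonal, Matrix.diagonal_mul_diagonal]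
        congr 1
        funext j
        by_cases hj : j = 0
        · subst hj; simp [h0]
        · simp [hj]
    rw [hmid]
    calc X = u * S * v := hX
      _ = u * (hDiag (star u.det * u.det) * S * hDiag (v.det * star v.det)) * v := by
        rw [mul_comm v.det, hdu, hdv, hDiag_one]; simp
      _ = _ := by
        rw [← hDiag_mul, ← hDiag_mul, ← hDiag_mul]
        simp only [Matrix.mul_assoc]
        rw [← Matrix.mul_assoc S, ← hDiag_comm_diagonal]
        simp only [Matrix.mul_assoc, S]

end SingularValues

theorem conjTranspose_mul_self_SU {n : Type} [Fintype n] [DecidableEq n] (g : SU n) :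
    g.1ᴴ * g.1 = 1 :=
  Matrix.mem_unitaryGroup_iff'.mp (Matrix.mem_specialUnitaryGroup_iff.mp g.2).1

/-! ### Contractions -/

section Contraction

variable {ι κ μ : Type*} [Fintype ι] [Fintype μ] [DecidableEq κ] [DecidableEq μ]

/-- A rectangular matrix `M` with `Mᴴ M ≤ 1`. -/
def IsContraction (M : Matrix ι κ ℂ) : Prop := (1 - Mᴴ * M).PosSemidef

theorem IsContraction.mul [Fintype κ] {A : Matrix ι κ ℂ} {B : Matrix κ μ ℂ} (hA : IsContraction A)
    (hB : IsContraction B) : IsContraction (A * B) := by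
  have : 1 - (A * B)ᴴ * (A * B) = Bᴴ * (1 - Aᴴ * A) * B + (1 - Bᴴ * B) := by
    simp [Matrix.mul_sub, Matrix.sub_mul, Matrix.mul_assoc]
  rw [IsContraction, this]
  exact (hA.conjTranspose_mul_mul_same B).add hB

theorem isContraction_of_conjTranspose_mul_self {A : Matrix ι κ ℂ} (h : Aᴴ * A = 1) :
    IsContraction A := by
  rw [IsContraction, h, sub_self]
  exact Matrix.PosSemidef.zero

/-- `Aᴴ * A` is an orthogonal projection, hence so is `1 - Aᴴ * A`, and a projection is its own Gram
matrix. -/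
theorem isContraction_of_self_mul_conjTranspose [Fintype κ] [DecidableEq ι] {A : Matrix ι κ ℂ} (h : A * Aᴴ = 1) :
    IsContraction A := by
  have : 1 - Aᴴ * A = (1 - Aᴴ * A)ᴴ * (1 - Aᴴ * A) := by
    have h1 : Aᴴ * A * (Aᴴ * A) = Aᴴ * A := by
      rw [Matrix.mul_assoc, ← Matrix.mul_assoc A, h, Matrix.one_mul]
    simp [Matrix.mul_sub, Matrix.sub_mul, h1]
  rw [IsContraction, this]
  exact Matrix.posSemidef_conjTranspose_mul_self _

theorem isContraction_of_mem_unitaryGroup [DecidableEq ι] {A : Matrix ι ι ℂ}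
    (h : A ∈ Matrix.unitaryGroup ι ℂ) : IsContraction A :=
  isContraction_of_conjTranspose_mul_self (Matrix.mem_unitaryGroup_iff'.mp h)

theorem isContraction_fromBlocks_zero [Fintype κ] [DecidableEq ι] {A : Matrix ι ι ℂ}
    {B : Matrix κ κ ℂ} (hA : IsContraction A)
    (hB : Bᴴ * B = 1) : IsContraction (Matrix.fromBlocks A 0 0 B) := by
  have : 1 - (Matrix.fromBlocks A 0 0 B)ᴴ * Matrix.fromBlocks A 0 0 B =
      (Matrix.fromCols (1 : Matrix ι ι ℂ) (0 : Matrix ι κ ℂ))ᴴ * (1 - Aᴴ * A) *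
        Matrix.fromCols (1 : Matrix ι ι ℂ) (0 : Matrix ι κ ℂ) := by
    rw [Matrix.fromBlocks_conjTranspose, Matrix.fromBlocks_multiply, ← Matrix.fromBlocks_one,
      Matrix.conjTranspose_fromCols_eq_fromRows_conjTranspose, Matrix.fromRows_mul,
      Matrix.fromRows_mul_fromCols]
    ext (i | i) (j | j) <;> simp [hB, Matrix.one_apply]
  rw [IsContraction, this]
  exact hA.conjTranspose_mul_mul_same _

theorem isClosed_setOf_isContraction [Fintype κ] : IsClosed {M : Matrix ι κ ℂ | IsContraction M} := by
  have : {M : Matrix ι κ ℂ | IsContraction M} =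
      ⋂ x : κ → ℂ, {M | 0 ≤ star x ⬝ᵥ ((1 - Mᴴ * M) *ᵥ x)} := by
    ext M
    simp only [Set.mem_ofPred_eq, Set.mem_iInter]
    rw [IsContraction, Matrix.posSemidef_iff_dotProduct_mulVec]
    exact ⟨fun h => h.2, fun h => ⟨by
      simp [Matrix.IsHermitian, Matrix.conjTranspose_sub], h⟩⟩
  rw [this]
  refine isClosed_iInter fun x => isClosed_le continuous_const ?_
  refine Continuous.dotProduct continuous_const (Continuous.matrix_mulVec ?_ continuous_const)
  exact continuous_const.sub (continuous_id.matrix_conjTranspose.matrix_mul continuous_id)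

theorem IsContraction.sing_le_one {q : ℕ} {M : Matrix (Fin q) (Fin q) ℂ} (h : IsContraction M)
    (i : Fin q) : sing M i ≤ 1 := by
  obtain ⟨u, hu, v, hv, hM⟩ := exists_svd M
  have hS : IsContraction (Matrix.diagonal (fun i => (sing M i : ℂ))) := by
    have : Matrix.diagonal (fun i => (sing M i : ℂ)) = star u * M * star v := by
      generalize Matrix.diagonal (fun i => (sing M i : ℂ)) = S at hM
      rw [hM]
      simp only [Matrix.mul_assoc, Matrix.mem_unitaryGroup_iff.mp hv, Matrix.mul_one]
      rw [← Matrix.mul_assoc, Matrix.mem_unitaryGroup_iff'.mp hu, Matrix.one_mul]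
    rw [this]
    exact ((isContraction_of_mem_unitaryGroup (Unitary.star_mem hu)).mul h).mul
      (isContraction_of_mem_unitaryGroup (Unitary.star_mem hv))
  have := Matrix.PosSemidef.diag_nonneg hS (i := i)
  rw [Matrix.diagonal_conjTranspose, Matrix.diagonal_mul_diagonal] at this
  simp only [Matrix.sub_apply, Matrix.one_apply_eq, Matrix.diagonal_apply_eq, Pi.star_apply] at this
  have h2 : (0 : ℂ) ≤ ((1 - sing M i * sing M i : ℝ) : ℂ) := by
    convert this using 1
    simp
  rw [Complex.zero_le_real] at h2
  nlinarith [sing_nonneg M i]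

/-- `M` is the product of the coisometry `(-sin t, cos t)`, the contraction `diag(w, v)` and the
isometry with blocks `sin t'`, `cos t'`. -/
theorem isContraction_mixed {q : ℕ} (t t' : Fin q → ℝ) {w : Fin q → Fin q → ℂ} (hw : w ∈ matrixBall q)
    (v : SU (Fin q)) : IsContraction (mixed t t' w v) := by
  have hcs : ∀ t : Fin q → ℝ, sinD t * sinD t + cosD t * cosD t = 1 := by
    intro t
    rw [sinD, cosD, Matrix.diagonal_mul_diagonal, Matrix.diagonal_mul_diagonal,
      Matrix.diagonal_add, ← Matrix.diagonal_one]
    congr 1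
    funext i
    have := Real.sin_sq_add_cos_sq (t i)
    exact_mod_cast (by nlinarith : Real.sin (t i) * Real.sin (t i) +
      Real.cos (t i) * Real.cos (t i) = 1)
  have hs : ∀ t : Fin q → ℝ, (sinD t)ᴴ = sinD t := by
    intro t; rw [sinD, Matrix.diagonal_conjTranspose]; congr 1; funext i; exact Complex.conj_ofReal _
  have hc : ∀ t : Fin q → ℝ, (cosD t)ᴴ = cosD t := by
    intro t; rw [cosD, Matrix.diagonal_conjTranspose]; congr 1; funext i; exact Complex.conj_ofReal _
  have : mixed t t' w v = Matrix.fromCols (-sinD t) (cosD t) *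
      Matrix.fromBlocks (Matrix.of w) 0 0 v.1 * Matrix.fromRows (sinD t') (cosD t') := by
    rw [Matrix.fromCols_mul_fromBlocks, Matrix.fromCols_mul_fromRows]
    simp [mixed]
  rw [this]
  refine ((isContraction_of_self_mul_conjTranspose ?_).mul
    (isContraction_fromBlocks_zero hw (conjTranspose_mul_self_SU v))).mul
    (isContraction_of_conjTranspose_mul_self ?_)
  · rw [Matrix.conjTranspose_fromCols_eq_fromRows_conjTranspose, Matrix.fromCols_mul_fromRows,
      Matrix.conjTranspose_neg, hs, hc, neg_mul_neg, hcs]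
  · rw [Matrix.conjTranspose_fromRows_eq_fromCols_conjTranspose, Matrix.fromCols_mul_fromRows,
      hs, hc, hcs]

end Contraction

/-! ### Double cosets and the cone -/

section DoubleCosets

variable {p q : ℕ}

theorem toBlocks_mul {l m n o r s : Type*} [Fintype n] [Fintype o] (M : Matrix (l ⊕ m) (n ⊕ o) ℂ)
    (N : Matrix (n ⊕ o) (r ⊕ s) ℂ) :
    M * N = Matrix.fromBlocks (M.toBlocks₁₁ * N.toBlocks₁₁ + M.toBlocks₁₂ * N.toBlocks₂₁)
      (M.toBlocks₁₁ * N.toBlocks₁₂ + M.toBlocks₁₂ * N.toBlocks₂₂)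
      (M.toBlocks₂₁ * N.toBlocks₁₁ + M.toBlocks₂₂ * N.toBlocks₂₁)
      (M.toBlocks₂₁ * N.toBlocks₁₂ + M.toBlocks₂₂ * N.toBlocks₂₂) := by
  conv_lhs => rw [← Matrix.fromBlocks_toBlocks M, ← Matrix.fromBlocks_toBlocks N]
  rw [Matrix.fromBlocks_multiply]

theorem embK_mul_val (k : SU (Fin p) × SU (Fin q)) (g : SU (Fin p ⊕ Fin q)) :
    (embK p q k * g).1 = Matrix.fromBlocks (k.1.1 * g.1.toBlocks₁₁) (k.1.1 * g.1.toBlocks₁₂)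
      (k.2.1 * g.1.toBlocks₂₁) (k.2.1 * g.1.toBlocks₂₂) := by
  change (embK p q k).1 * g.1 = _
  rw [toBlocks_mul]
  simp [embK]

theorem mul_embK_val (k : SU (Fin p) × SU (Fin q)) (g : SU (Fin p ⊕ Fin q)) :
    (g * embK p q k).1 = Matrix.fromBlocks (g.1.toBlocks₁₁ * k.1.1) (g.1.toBlocks₁₂ * k.2.1)
      (g.1.toBlocks₂₁ * k.1.1) (g.1.toBlocks₂₂ * k.2.1) := by
  change g.1 * (embK p q k).1 = _
  rw [toBlocks_mul]
  simp [embK]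

theorem columns_gram (g : SU (Fin p ⊕ Fin q)) :
    g.1.toBlocks₁₂ᴴ * g.1.toBlocks₁₂ + g.1.toBlocks₂₂ᴴ * g.1.toBlocks₂₂ = 1 := by
  have := congrArg Matrix.toBlocks₂₂ (conjTranspose_mul_self_SU g)
  rw [toBlocks_mul, Matrix.toBlocks_fromBlocks₂₂] at this
  refine Eq.trans ?_ (this.trans ?_)
  · rfl
  · rw [← Matrix.fromBlocks_one, Matrix.toBlocks_fromBlocks₂₂]

theorem isContraction_toBlocks₂₂ (g : SU (Fin p ⊕ Fin q)) : IsContraction g.1.toBlocks₂₂ := by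
  rw [IsContraction, ← columns_gram g, add_sub_cancel_right]
  exact Matrix.posSemidef_conjTranspose_mul_self _

/-- The lower right block determines the double coset. -/
theorem exists_embK_of_toBlocks₂₂_eq (hqp : q < p) {g h : SU (Fin p ⊕ Fin q)}
    (hD : g.1.toBlocks₂₂ = h.1.toBlocks₂₂) :
    ∃ k l, h = embK p q k * g * embK p q l := by
  obtain ⟨u, hu, huB⟩ := exists_specialUnitary_of_gram_eq (X := g.1.toBlocks₁₂)
    (Y := h.1.toBlocks₁₂) (by simpa using hqp) (by
      have h1 := columns_gram g
      rw [hD, ← columns_gram h] at h1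
      exact add_right_cancel h1)
  let k : SU (Fin p) × SU (Fin q) := (⟨u, hu⟩, 1)
  set g' := embK p q k * g with hg'
  have h12 : g'.1.toBlocks₁₂ = h.1.toBlocks₁₂ := by
    rw [hg', embK_mul_val, Matrix.toBlocks_fromBlocks₁₂, huB]
  have h22 : g'.1.toBlocks₂₂ = h.1.toBlocks₂₂ := by
    rw [hg', embK_mul_val, Matrix.toBlocks_fromBlocks₂₂, ← hD]
    exact Matrix.one_mul _
  -- Once the last `q` columns of `g'` and `h` agree, those of `g'⁻¹ h` are standard basis vectors.
  -- Applying this in both orders shows that `g'⁻¹ h` is block diagonal with lower block `1`.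
  have key : ∀ a b : SU (Fin p ⊕ Fin q), a.1.toBlocks₁₂ = b.1.toBlocks₁₂ →
      a.1.toBlocks₂₂ = b.1.toBlocks₂₂ →
      (a.1ᴴ * b.1).toBlocks₁₂ = 0 ∧ (a.1ᴴ * b.1).toBlocks₂₂ = 1 := by
    intro a b e1 e2
    have h1 := conjTranspose_mul_self_SU a
    rw [toBlocks_mul, e1, e2, ← Matrix.fromBlocks_one, Matrix.fromBlocks_inj] at h1
    rw [toBlocks_mul]
    exact ⟨h1.2.1, h1.2.2.2⟩
  set m : SU (Fin p ⊕ Fin q) := g'⁻¹ * h with hm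
  have hmv : m.1 = g'.1ᴴ * h.1 := rfl
  have hm' : m.1ᴴ = h.1ᴴ * g'.1 := by
    rw [hmv, Matrix.conjTranspose_mul, Matrix.conjTranspose_conjTranspose]
  obtain ⟨a1, a2⟩ := key g' h h12 h22
  obtain ⟨b1, -⟩ := key h g' h12.symm h22.symm
  rw [← hmv] at a1 a2
  have a3 : m.1.toBlocks₂₁ = 0 := by
    rw [← hm'] at b1
    have : m.1.toBlocks₂₁ = (m.1ᴴ.toBlocks₁₂)ᴴ := by ext; simp [Matrix.toBlocks₁₂, Matrix.toBlocks₂₁]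
    rw [this, b1, Matrix.conjTranspose_zero]
  have hmb : m.1 = Matrix.fromBlocks m.1.toBlocks₁₁ 0 0 1 := by
    rw [← a1, ← a2]
    conv_rhs => rw [← a3]
    rw [Matrix.fromBlocks_toBlocks]
  have hl : m.1.toBlocks₁₁ ∈ Matrix.specialUnitaryGroup (Fin p) ℂ := by
    rw [Matrix.mem_specialUnitaryGroup_iff, Matrix.mem_unitaryGroup_iff']
    constructor
    · have h1 := conjTranspose_mul_self_SU m
      rw [hmb, Matrix.fromBlocks_conjTranspose, Matrix.fromBlocks_multiply,
        ← Matrix.fromBlocks_one, Matrix.fromBlocks_inj] at h1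
      simpa [Matrix.star_eq_conjTranspose] using h1.1
    · have h1 := (Matrix.mem_specialUnitaryGroup_iff.mp m.2).2
      rw [hmb] at h1
      simpa using h1
  refine ⟨k, (⟨_, hl⟩, 1), ?_⟩
  have : embK p q (⟨_, hl⟩, 1) = m := by
    exact Subtype.ext hmb.symm
  rw [this, ← hg', hm, mul_inv_cancel_left]

theorem IsSpherical.eq_of_toBlocks₂₂_eq {φ : SU (Fin p ⊕ Fin q) → ℂ} (hφ : IsSpherical p q φ)
    (hqp : q < p) {g h : SU (Fin p ⊕ Fin q)} (hD : g.1.toBlocks₂₂ = h.1.toBlocks₂₂) :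
    φ g = φ h := by
  obtain ⟨k, l, rfl⟩ := exists_embK_of_toBlocks₂₂_eq hqp hD
  exact (hφ.biinvariant k l g).symm

variable [NeZero q]

theorem rep_toBlocks₂₂ (hqp : q ≤ p) (t : Fin q → ℝ) (z : Circle) :
    (rep hqp t z).1.toBlocks₂₂ = hDiag (z : ℂ) * cosD t := by
  ext i j
  simp [rep, blockEquiv, Matrix.toBlocks₂₂, rotBlock]

theorem radial_bracket {r : Fin q → ℝ} (h : 0 ≤ r 0) (z : Circle) : radial (bracket r z) = r := by
  funext i
  by_cases hi : (i : ℕ) = 0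
  · have : i = 0 := Fin.ext hi
    subst this
    simp only [radial, bracket, dif_pos hi, norm_mul, Circle.norm_coe, one_mul]
    exact Complex.norm_of_nonneg h
  · simp only [radial, hi, dif_neg, not_false_iff, bracket]
    congr 1
    ext
    simp
    omega

theorem circle_star_mul_self (z : Circle) : star (z : ℂ) * (z : ℂ) = 1 := by
  have : star (z : ℂ) = ((z⁻¹ : Circle) : ℂ) := (Circle.coe_inv_eq_conj z).symm
  rw [this, ← Circle.coe_mul]; simp

theorem argT_coe_mul_ofReal_of_pos (z : Circle) {r : ℝ} (hr : 0 < r) :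
    argT ((z : ℂ) * r) = z :=
  Circle.ext (argT_mul_ofReal_of_pos (circle_star_mul_self z) hr)

theorem argT_coe_mul (z : Circle) {d : ℂ} (hd : d ≠ 0) : argT (z * d) = z * argT d := by
  have : (z : ℂ) * d = ((z * argT d : Circle) : ℂ) * (‖d‖ : ℝ) := by
    rw [Circle.coe_mul, coe_argT, if_neg hd]
    have : (‖d‖ : ℂ) ≠ 0 := by simpa using hd
    field_simp
  rw [this, argT_coe_mul_ofReal_of_pos _ (norm_pos_iff.mpr hd)]

/-- The parameter `z` enters only multiplied by `cos (t 0)`. Hence the value of `argT` at `0` used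
in `onCone` is harmless. -/
theorem rep_congr_of_cos_eq_zero (hqp : q ≤ p) {t : Fin q → ℝ} (ht : Real.cos (t 0) = 0)
    (z z' : Circle) : rep hqp t z = rep hqp t z' := by
  have : ∀ w : ℂ, hDiag w * cosD t = hDiag 1 * cosD t := by
    intro w
    rw [hDiag, hDiag, cosD, Matrix.diagonal_mul_diagonal, Matrix.diagonal_mul_diagonal]
    congr 1
    funext j
    by_cases hj : j = 0
    · subst hj; simp [ht]
    · simp [hj]
  apply Subtype.ext
  simp only [rep, rotBlock, this]

theorem onCone_bracket (hqp : q ≤ p) (φ : SU (Fin p ⊕ Fin q) → ℂ) {r : Fin q → ℝ} (h : 0 ≤ r 0)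
    (z : Circle) : onCone hqp φ (bracket r z) = φ (rep hqp (fun i => Real.arccos (r i)) z) := by
  rw [onCone, radial_bracket h]
  rcases h.lt_or_eq with h | h
  · rw [bracket, argT_coe_mul_ofReal_of_pos z h]
  · congr 1
    exact rep_congr_of_cos_eq_zero hqp (by simp [← h]) _ _

theorem onCone_bracket_cos (hqp : q ≤ p) (φ : SU (Fin p ⊕ Fin q) → ℂ) {t : Fin q → ℝ}
    (ht : t ∈ alcove q) (z : Circle) :
    onCone hqp φ (bracket (fun i => Real.cos (t i)) z) = φ (rep hqp t z) := by
  have h := ht.2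
  rw [onCone_bracket hqp φ]
  · congr 2
    funext i
    exact Real.arccos_cos (h i).1 ((h i).2.trans (by linarith [Real.pi_pos]))
  · exact Real.cos_nonneg_of_mem_Icc ⟨by linarith [Real.pi_pos, (h 0).1], (h 0).2⟩

theorem bracket_sing_mem_cone {M : Matrix (Fin q) (Fin q) ℂ} (hM : IsContraction M) (z : Circle) :
    bracket (sing M) z ∈ cone q :=
  ⟨_, z, sing_monotone M, fun i => ⟨sing_nonneg M i, hM.sing_le_one i⟩, rfl⟩

/-- The point of the cone attached to a `q × q` matrix. -/
def matCoord (M : Matrix (Fin q) (Fin q) ℂ) : ℂ × (Fin (q - 1) → ℝ) :=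
  bracket (sing M) (argT M.det)

/-- The special singular value decomposition of `M` supplies the two `SU(q)` factors. Contractivity
puts the singular values in `[0, 1]`, where `cos (arccos r) = r`. -/
theorem exists_toBlocks₂₂_eq (hqp : q ≤ p) {M : Matrix (Fin q) (Fin q) ℂ} (hM : IsContraction M) :
    ∃ k l, (embK p q k * rep hqp (fun i => Real.arccos (sing M i)) (argT M.det) *
      embK p q l).1.toBlocks₂₂ = M := by
  obtain ⟨u, v, h⟩ := exists_special_svd M
  refine ⟨(1, u), (1, v), ?_⟩
  rw [mul_embK_val, Matrix.toBlocks_fromBlocks₂₂, embK_mul_val, Matrix.toBlocks_fromBlocks₂₂,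
    rep_toBlocks₂₂]
  have hc : cosD (fun i => Real.arccos (sing M i)) =
      Matrix.diagonal (fun i => (sing M i : ℂ)) := by
    rw [cosD]
    refine congrArg _ (funext fun i => ?_)
    rw [Real.cos_arccos (by linarith [sing_nonneg M i]) (hM.sing_le_one i)]
  rw [hc]
  exact h.symm

theorem IsSpherical.eq_onCone_matCoord {φ : SU (Fin p ⊕ Fin q) → ℂ} (hφ : IsSpherical p q φ)
    (hqp : q < p) (g : SU (Fin p ⊕ Fin q)) :
    φ g = onCone hqp.le φ (matCoord g.1.toBlocks₂₂) := by
  obtain ⟨k, l, h⟩ := exists_toBlocks₂₂_eq hqp.le (isContraction_toBlocks₂₂ g)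
  rw [matCoord, onCone_bracket _ _ (sing_nonneg _ 0), ← hφ.eq_of_toBlocks₂₂_eq hqp h,
    hφ.biinvariant]

/-- The phase of the determinant is discontinuous at determinant zero, so continuity is not checked
coordinatewise. Instead, `g ↦ D(g)` is a continuous surjection from a compact group onto the
contractions, hence a quotient map, and the function pulls back to `φ`. -/
theorem continuousOn_onCone_matCoord {φ : SU (Fin p ⊕ Fin q) → ℂ} (hφ : IsSpherical p q φ)
    (hqp : q < p) :
    ContinuousOn (fun M => onCone hqp.le φ (matCoord M)) {M | IsContraction M} := by
  rw [continuousOn_iff_continuous_domRestrict]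
  let D : SU (Fin p ⊕ Fin q) → {M : Matrix (Fin q) (Fin q) ℂ // IsContraction M} :=
    fun g => ⟨g.1.toBlocks₂₂, isContraction_toBlocks₂₂ g⟩
  have hD : Continuous D := by
    refine Continuous.subtype_mk ?_ _
    exact continuous_subtype_val.matrix_submatrix Sum.inr Sum.inr
  have hs : Function.Surjective D := by
    rintro ⟨M, hM⟩
    obtain ⟨k, l, h⟩ := exists_toBlocks₂₂_eq hqp.le hM
    exact ⟨_, Subtype.ext h⟩
  have hq := Topology.IsQuotientMap.of_surjective_continuous hs hD
  refine hq.continuous_iff.mpr ?_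
  convert hφ.continuous using 1
  funext g
  exact (hφ.eq_onCone_matCoord hqp g).symm

/-- Left multiplication by `h(z)` keeps the Gram matrix and multiplies the determinant by `z`. If
the determinant vanishes, `argT` is not multiplicative, but then `sing M 0 = 0` and `bracket`
ignores the phase. -/
theorem matCoord_hDiag_mul (z : Circle) (M : Matrix (Fin q) (Fin q) ℂ) (φ : _ → ℂ)
    (hqp : q ≤ p) :
    onCone (p := p) hqp φ (matCoord (hDiag (z : ℂ) * M)) =
      onCone hqp φ (bracket (sing M) (z * argT M.det)) := by
  have hs : sing (hDiag (z : ℂ) * M) = sing M := by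
    apply sing_congr
    rw [Matrix.conjTranspose_mul, Matrix.mul_assoc, ← Matrix.mul_assoc (hDiag _)ᴴ,
      hDiag_conjTranspose, hDiag_mul, circle_star_mul_self, hDiag_one, Matrix.one_mul]
  rw [matCoord, hs, Matrix.det_mul, det_hDiag]
  by_cases hd : M.det = 0
  · have h0 : sing M 0 = 0 := by
      obtain ⟨u, hu, v, hv, hM⟩ := exists_svd M
      have hu0 := right_ne_zero_of_mul (ne_of_eq_of_ne
        (star_det_mul_det_of_mem_unitaryGroup hu) one_ne_zero)
      have hv0 := right_ne_zero_of_mul (ne_of_eq_of_ne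
        (star_det_mul_det_of_mem_unitaryGroup hv) one_ne_zero)
      have h1 := hd
      rw [hM, Matrix.det_mul, Matrix.det_mul, mul_eq_zero, mul_eq_zero, or_iff_left hv0,
        or_iff_right hu0, Matrix.det_diagonal, Finset.prod_eq_zero_iff] at h1
      obtain ⟨i, -, hi⟩ := h1
      have hi : sing M i = 0 := by exact_mod_cast hi
      exact le_antisymm ((sing_monotone M (Fin.zero_le i)).trans hi.le) (sing_nonneg M 0)
    simp [bracket, h0]
  · rw [argT_coe_mul z hd]

end DoubleCosets

/-! ### Haar measure on `U(n)` and `SU(n)` -/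

section Haar

variable {n : Type} [Fintype n] [DecidableEq n]

instance instSecondCountableTopologyMatrix {m n : Type*} [Fintype m] [Fintype n] :
    SecondCountableTopology (Matrix m n ℂ) :=
  inferInstanceAs (SecondCountableTopology (m → n → ℂ))

instance SU.instSecondCountableTopology : SecondCountableTopology (SU n) :=
  Topology.IsEmbedding.subtypeVal.secondCountableTopology

instance SU.instIsHaarMeasure : (haarSU n).IsHaarMeasure :=
  inferInstanceAs (Measure.haarMeasure ⊤).IsHaarMeasure

instance SU.instIsProbabilityMeasure : IsProbabilityMeasure (haarSU n) :=
  ⟨Measure.haarMeasure_self (K₀ := ⊤)⟩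

instance unitaryGroup.instMeasurableSpace : MeasurableSpace (Matrix.unitaryGroup n ℂ) := borel _

instance unitaryGroup.instBorelSpace : BorelSpace (Matrix.unitaryGroup n ℂ) := ⟨rfl⟩

instance unitaryGroup.instSecondCountableTopology :
    SecondCountableTopology (Matrix.unitaryGroup n ℂ) :=
  Topology.IsEmbedding.subtypeVal.secondCountableTopology

instance unitaryGroup.instCompactSpace : CompactSpace (Matrix.unitaryGroup n ℂ) := by
  have hsub : ((Matrix.unitaryGroup n ℂ : Submonoid (Matrix n n ℂ)) : Set (Matrix n n ℂ)) ⊆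
      Set.pi Set.univ (fun _ : n => Set.pi Set.univ fun _ : n => Metric.closedBall (0 : ℂ) 1) := by
    intro A hA i _ j _
    simpa using entry_norm_bound_of_unitary hA i j
  have hcl : IsClosed
      ((Matrix.unitaryGroup n ℂ : Submonoid (Matrix n n ℂ)) : Set (Matrix n n ℂ)) := by
    have : ((Matrix.unitaryGroup n ℂ : Submonoid (Matrix n n ℂ)) : Set (Matrix n n ℂ)) =
        {A | A * star A = 1} := by
      ext A
      simp [Matrix.mem_unitaryGroup_iff]
    rw [this]
    exact isClosed_eq (continuous_id.mul continuous_star) continuous_const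
  have hK : IsCompact
      (Set.pi Set.univ (fun _ : n => Set.pi Set.univ fun _ : n => Metric.closedBall (0 : ℂ) 1)) :=
    isCompact_univ_pi fun _ => isCompact_univ_pi fun _ => isCompact_closedBall _ _
  exact isCompact_iff_compactSpace.mp (hK.of_isClosed_subset hcl hsub)

variable (n) in
/-- The normalized Haar measure on `U(n)`. -/
def haarU : Measure (Matrix.unitaryGroup n ℂ) := Measure.haarMeasure ⊤

instance unitaryGroup.instIsHaarMeasure : (haarU n).IsHaarMeasure :=
  inferInstanceAs (Measure.haarMeasure ⊤).IsHaarMeasure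

instance unitaryGroup.instIsProbabilityMeasure : IsProbabilityMeasure (haarU n) :=
  ⟨Measure.haarMeasure_self (K₀ := ⊤)⟩

/-- The Haar probability measure of a compact group is right invariant. -/
theorem isMulRightInvariant_of_compactSpace {G : Type*} [Group G] [TopologicalSpace G]
    [IsTopologicalGroup G] [CompactSpace G] [MeasurableSpace G] [BorelSpace G] (μ : Measure G)
    [μ.IsHaarMeasure] [IsProbabilityMeasure μ] : μ.IsMulRightInvariant := by
  refine ⟨fun g => ?_⟩
  have : IsProbabilityMeasure (μ.map (· * g)) :=
    Measure.isProbabilityMeasure_map (measurable_mul_const g).aemeasurable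
  exact Measure.isHaarMeasure_eq_of_isProbabilityMeasure _ _

instance unitaryGroup.instIsMulRightInvariant : (haarU n).IsMulRightInvariant :=
  isMulRightInvariant_of_compactSpace _

instance SU.instIsMulRightInvariant : (haarSU n).IsMulRightInvariant :=
  isMulRightInvariant_of_compactSpace _

end Haar

/-! ### Complex linear changes of variables -/

section LinearChange

variable {ι : Type*} [Fintype ι] [DecidableEq ι]

/-- The real determinant of a complex linear map is the squared modulus of its complex determinant.
-/
theorem map_vecMul_volume {A : Matrix ι ι ℂ} (hA : A.det ≠ 0) :
    Measure.map (fun x : ι → ℂ => x ᵥ* A) volume = ENNReal.ofReal (‖A.det‖ ^ 2)⁻¹ • volume := by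
  have hd : LinearMap.det (A.vecMulLinear.restrictScalars ℝ) = ‖A.det‖ ^ 2 := by
    have h1 : (A.vecMulLinear : (ι → ℂ) →ₗ[ℂ] (ι → ℂ)) = Matrix.toLin' Aᵀ := by
      ext; simp
    rw [LinearMap.det_restrictScalars, h1, LinearMap.det_toLin', Matrix.det_transpose,
      Algebra.norm_complex_eq]
    exact Complex.normSq_eq_norm_sq _
  have h2 : ‖A.det‖ ^ 2 ≠ 0 := by simpa using hA
  have := Measure.map_linearMap_addHaar_eq_smul_addHaar (volume : Measure (ι → ℂ))
    (f := A.vecMulLinear.restrictScalars ℝ) (by rw [hd]; exact h2)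
  rw [hd, abs_of_nonneg (by positivity)] at this
  exact this

theorem measurePreserving_vecMul_of_mem_unitaryGroup {A : Matrix ι ι ℂ}
    (hA : A ∈ Matrix.unitaryGroup ι ℂ) :
    MeasurePreserving (fun x : ι → ℂ => x ᵥ* A) volume volume := by
  have h1 := star_det_mul_det_of_mem_unitaryGroup hA
  have h2 : ‖A.det‖ = 1 := by
    have h2 := congrArg norm h1
    rw [norm_mul, norm_star, norm_one] at h2
    nlinarith [norm_nonneg A.det]
  refine ⟨(Continuous.matrix_vecMul continuous_id continuous_const).measurable, ?_⟩
  rw [map_vecMul_volume (by rintro h; simp [h] at h2), h2]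
  simp

theorem map_rows_vecMul_volume {α : Type*} [Fintype α] {A : Matrix ι ι ℂ} (hA : A.det ≠ 0) :
    Measure.map (fun (W : α → ι → ℂ) i => W i ᵥ* A) volume =
      ENNReal.ofReal (‖A.det‖ ^ 2)⁻¹ ^ Fintype.card α • volume := by
  have hm : Measurable fun x : ι → ℂ => x ᵥ* A :=
    (Continuous.matrix_vecMul continuous_id continuous_const).measurable
  have hs : SigmaFinite (ENNReal.ofReal (‖A.det‖ ^ 2)⁻¹ • (volume : Measure (ι → ℂ))) :=
    SMul.sigmaFinite (Real.toNNReal (‖A.det‖ ^ 2)⁻¹)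
  have : ∀ _ : α, SigmaFinite (Measure.map (fun x : ι → ℂ => x ᵥ* A) volume) := fun _ => by
    rw [map_vecMul_volume hA]; exact hs
  have h := Measure.pi_map_pi (ι := α) (X := fun _ => ι → ℂ) (Y := fun _ => ι → ℂ)
    (μ := fun _ => volume) (f := fun _ x => x ᵥ* A) (hμ := this) (fun _ => hm.aemeasurable)
  refine h.trans ?_
  simp only [map_vecMul_volume hA]
  refine (Measure.pi_eq fun s hs => ?_)
  rw [Measure.smul_apply, volume_pi_pi]
  simp [Finset.prod_mul_distrib]

end LinearChange

/-! ### The law of the squared length under Lebesgue measure -/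

section NormSq

variable {ι : Type*} [Fintype ι]

/-- The squared Euclidean length. -/
def nsq (x : ι → ℂ) : ℝ := ∑ i, ‖x i‖ ^ 2

theorem nsq_nonneg (x : ι → ℂ) : 0 ≤ nsq x := Finset.sum_nonneg fun _ _ => sq_nonneg _

theorem continuous_nsq : Continuous (nsq : (ι → ℂ) → ℝ) := by
  unfold nsq; fun_prop

theorem measurable_nsq : Measurable (nsq : (ι → ℂ) → ℝ) := continuous_nsq.measurable

theorem nsq_eq_zero {x : ι → ℂ} : nsq x = 0 ↔ x = 0 := by
  rw [nsq, Finset.sum_eq_zero_iff_of_nonneg fun _ _ => sq_nonneg _]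
  simp [funext_iff]

theorem nsq_smul (r : ℝ) (x : ι → ℂ) : nsq (r • x) = r ^ 2 * nsq x := by
  simp [nsq, Finset.mul_sum, mul_pow]

theorem ofReal_nsq (x : ι → ℂ) : (nsq x : ℂ) = x ⬝ᵥ star x := by
  simp [nsq, dotProduct, Complex.mul_conj, Complex.normSq_eq_norm_sq]

theorem nsq_vecMul [DecidableEq ι] {u : Matrix ι ι ℂ} (hu : u ∈ Matrix.unitaryGroup ι ℂ)
    (x : ι → ℂ) : nsq (x ᵥ* u) = nsq x := by
  have : (nsq (x ᵥ* u) : ℂ) = nsq x := by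
    rw [ofReal_nsq, ofReal_nsq, Matrix.star_vecMul, Matrix.dotProduct_mulVec, Matrix.vecMul_vecMul,
      ← Matrix.star_eq_conjTranspose, Matrix.mem_unitaryGroup_iff.mp hu, Matrix.vecMul_one]
  exact_mod_cast this

/-- For `t > 0`, scaling by `√t` in real dimension `2d` multiplies volume by `t ^ d`. The `max`
covers negative `t`, where the set is empty and `d > 0` makes the right side vanish. -/
theorem volume_nsq_le (ι : Type*) [Fintype ι] [Nonempty ι] (t : ℝ) :
    volume {x : ι → ℂ | nsq x ≤ t} =
      ENNReal.ofReal (max t 0 ^ Fintype.card ι) * volume {x : ι → ℂ | nsq x ≤ 1} := by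
  rcases lt_trichotomy t 0 with ht | rfl | ht
  · have : {x : ι → ℂ | nsq x ≤ t} = ∅ := by
      ext x; simpa using ht.trans_le (nsq_nonneg x)
    rw [this, max_eq_right ht.le]
    simp
  · have : {x : ι → ℂ | nsq x ≤ 0} = {0} := by
      ext x
      exact ⟨fun h => nsq_eq_zero.mp (le_antisymm h (nsq_nonneg x)), fun h => (nsq_eq_zero.mpr h).le⟩
    rw [this]
    simp
  · have : {x : ι → ℂ | nsq x ≤ t} = √t • {x : ι → ℂ | nsq x ≤ 1} := by
      ext x
      rw [Set.mem_smul_set_iff_inv_smul_mem₀ (Real.sqrt_pos.mpr ht).ne']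
      change _ ↔ nsq _ ≤ 1
      rw [nsq_smul, inv_pow, Real.sq_sqrt ht.le, inv_mul_le_iff₀ ht, mul_one]
      rfl
    rw [this, Measure.addHaar_smul, max_eq_left ht.le]
    congr 2
    rw [Module.finrank_pi_fintype]
    simp only [Complex.finrank_real_complex, Finset.sum_const, Finset.card_univ, smul_eq_mul]
    rw [mul_comm, pow_mul, Real.sq_sqrt ht.le, abs_of_nonneg (by positivity)]

theorem volume_nsq_le_one_lt_top : volume {x : ι → ℂ | nsq x ≤ 1} < ∞ := by
  refine (measure_mono ?_).trans_lt (measure_closedBall_lt_top (x := (0 : ι → ℂ)) (r := 1))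
  intro x hx
  rw [mem_closedBall_zero_iff, pi_norm_le_iff_of_nonneg zero_le_one]
  intro i
  have h1 : ‖x i‖ ^ 2 ≤ nsq x := Finset.single_le_sum (f := fun i => ‖x i‖ ^ 2)
    (fun _ _ => sq_nonneg _) (Finset.mem_univ i)
  have h2 : nsq x ≤ 1 := hx
  nlinarith [norm_nonneg (x i)]

theorem volume_nsq_le_one_ne_zero : volume {x : ι → ℂ | nsq x ≤ 1} ≠ 0 := by
  have ho : IsOpen {x : ι → ℂ | nsq x < 1} := isOpen_lt continuous_nsq continuous_const
  have h0 : (0 : ι → ℂ) ∈ {x : ι → ℂ | nsq x < 1} := by simp [nsq]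
  exact ((ho.measure_pos volume ⟨0, h0⟩).trans_le (measure_mono fun x (hx : nsq x < 1) => hx.le)).ne'

/-- The image of Lebesgue measure under the squared length. -/
theorem map_nsq_volume (ι : Type*) [Fintype ι] [Nonempty ι] :
    Measure.map nsq (volume : Measure (ι → ℂ)) =
      (Fintype.card ι * volume {x : ι → ℂ | nsq x ≤ 1}) • volume.withDensity
        ((Set.Ioi (0 : ℝ)).indicator fun t => ENNReal.ofReal (t ^ (Fintype.card ι - 1))) := by
  set V := volume {x : ι → ℂ | nsq x ≤ 1}
  set d := Fintype.card ι with hd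
  have hd0 : d ≠ 0 := Fintype.card_ne_zero
  have hfin : ∀ t : ℝ, volume {x : ι → ℂ | nsq x ≤ t} ≠ ∞ := fun t => by
    rw [volume_nsq_le]
    exact (ENNReal.mul_lt_top ENNReal.ofReal_lt_top volume_nsq_le_one_lt_top).ne
  have hpre : ∀ a b : ℝ, nsq ⁻¹' Set.Ioc a b =
      {x : ι → ℂ | nsq x ≤ b} \ {x : ι → ℂ | nsq x ≤ a} := by
    intro a b; ext x; simp [and_comm]
  refine Measure.ext_of_Ioc' _ _ (fun a b _ => ?_) fun a b hab => ?_
  · rw [Measure.map_apply measurable_nsq measurableSet_Ioc, hpre]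
    exact ne_top_of_le_ne_top (hfin b) (measure_mono Set.sdiff_subset)
  · have hsub : {x : ι → ℂ | nsq x ≤ a} ⊆ {x : ι → ℂ | nsq x ≤ b} :=
      fun x (hx : nsq x ≤ a) => hx.trans hab.le
    rw [Measure.map_apply measurable_nsq measurableSet_Ioc, hpre,
      measure_sdiff hsub
        (measurableSet_le measurable_nsq measurable_const).nullMeasurableSet (hfin a),
      volume_nsq_le ι b, volume_nsq_le ι a, ← ENNReal.sub_mul (fun _ _ => volume_nsq_le_one_lt_top.ne),
      ← ENNReal.ofReal_sub _ (by positivity), Measure.smul_apply,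
      withDensity_apply _ measurableSet_Ioc, smul_eq_mul,
      setLIntegral_indicator measurableSet_Ioi]
    have hset : Set.Ioi (0 : ℝ) ∩ Set.Ioc a b = Set.Ioc (max a 0) (max b 0) := by
      ext x
      simp only [Set.mem_inter_iff, Set.mem_Ioi, Set.mem_Ioc, max_lt_iff, le_max_iff]
      constructor
      · rintro ⟨h1, h2, h3⟩; exact ⟨⟨h2, h1⟩, Or.inl h3⟩
      · rintro ⟨⟨h1, h2⟩, h3 | h3⟩
        · exact ⟨h2, h1, h3⟩
        · linarith
    have hab' : max a 0 ≤ max b 0 := max_le_max_right 0 hab.le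
    rw [hset, ← ofReal_integral_eq_lintegral_ofReal, ← intervalIntegral.integral_of_le hab',
      integral_pow, ← ENNReal.ofReal_natCast d, mul_right_comm, ← ENNReal.ofReal_mul (by positivity)]
    · congr 2
      rw [← hd]
      obtain ⟨e, he⟩ : ∃ e, d = e + 1 := ⟨d - 1, by omega⟩
      rw [he]
      push_cast
      field_simp
    · exact ((continuous_pow _).integrableOn_Icc).mono_set Set.Ioc_subset_Icc_self
    · refine (ae_restrict_iff' measurableSet_Ioc).mpr (Filter.Eventually.of_forall fun x hx => ?_)
      exact pow_nonneg ((le_max_right a 0).trans hx.1.le) _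

theorem volume_nsq_eq (ι : Type*) [Fintype ι] [Nonempty ι] (t : ℝ) :
    volume {x : ι → ℂ | nsq x = t} = 0 := by
  have h := DFunLike.congr_fun (map_nsq_volume ι) {t}
  rw [Measure.map_apply measurable_nsq (measurableSet_singleton t)] at h
  refine h.trans ?_
  rw [Measure.smul_apply, withDensity_apply _ (measurableSet_singleton t)]
  simp

end NormSq

/-! ### The law of part of a row of a Haar unitary -/

section SphereLaw

theorem exists_unitary_row_eq {ι : Type*} [Fintype ι] [DecidableEq ι] (i₀ : ι) {x : ι → ℂ}
    (hx : nsq x = 1) : ∃ u : Matrix.unitaryGroup ι ℂ, Pi.single i₀ 1 ᵥ* u.1 = x := by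
  obtain ⟨u, hu, h⟩ := exists_unitary_of_gram_eq
    (X := Matrix.replicateCol Unit (Pi.single i₀ (1 : ℂ)))
    (Y := Matrix.replicateCol Unit (star x)) (by
      ext
      have := ofReal_nsq x
      rw [hx] at this
      simpa [Matrix.mul_apply, Pi.single_apply, dotProduct] using this)
  refine ⟨⟨star u, Unitary.star_mem hu⟩, ?_⟩
  have h2 : star x = u *ᵥ Pi.single i₀ 1 := by
    funext i
    have := congrFun (congrFun h i) ()
    simpa [Matrix.mul_apply, Matrix.mulVec, dotProduct] using this
  have h3 := congrArg star h2
  rw [star_star, Matrix.star_mulVec] at h3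
  rw [h3]
  congr 1
  funext i
  simp [Pi.single_apply, apply_ite]

/-- The integral over `(y, u)` of a function of `y / |(y, u)|`, cut off to the unit ball. -/
theorem lintegral_normalized_fst (α β : Type) [Fintype α] [Fintype β] [Nonempty β] :
    ∃ C : ℝ≥0∞, ∀ f : (α → ℂ) → ℝ≥0∞, Measurable f →
      ∫⁻ y : α → ℂ, ∫⁻ u : β → ℂ, (Set.Iic (1 : ℝ)).indicator
        (fun ρ => f ((√ρ)⁻¹ • y)) (nsq y + nsq u) =
      C * ∫⁻ w : α → ℂ, f w * {w : α → ℂ | nsq w < 1}.indicator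
        (fun w => ENNReal.ofReal ((1 - nsq w) ^ (Fintype.card β - 1))) w := by
  set d := Fintype.card β
  set V := volume {x : β → ℂ | nsq x ≤ 1}
  set D : ℝ → ℝ≥0∞ := (Set.Ioi (0 : ℝ)).indicator fun t => ENNReal.ofReal (t ^ (d - 1)) with hD
  have hDm : Measurable D :=
    (Measurable.ennreal_ofReal (by fun_prop)).indicator measurableSet_Ioi
  refine ⟨d * V * ∫⁻ ρ : ℝ, (Set.Ioc 0 1).indicator
    (fun ρ => ENNReal.ofReal (ρ ^ Fintype.card α) * ENNReal.ofReal (ρ ^ (d - 1))) ρ, fun f hf => ?_⟩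
  set F : (α → ℂ) → ℝ → ℝ≥0∞ := fun y =>
    (Set.Iic (1 : ℝ)).indicator fun ρ => f ((√ρ)⁻¹ • y) with hF
  set I : ℝ≥0∞ := ∫⁻ w : α → ℂ, f w * {w : α → ℂ | nsq w < 1}.indicator
        (fun w => ENNReal.ofReal ((1 - nsq w) ^ (d - 1))) w
  have hFm : Measurable (Function.uncurry F) := by
    have : Function.uncurry F = (Prod.snd ⁻¹' Set.Iic (1 : ℝ)).indicator
        fun z : (α → ℂ) × ℝ => f ((√z.2)⁻¹ • z.1) := rfl
    rw [this]
    refine (hf.comp ?_).indicator (measurable_snd measurableSet_Iic)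
    exact (measurable_snd.sqrt.inv).smul measurable_fst
  have hFm' : ∀ y, Measurable (F y) := fun y => hFm.comp measurable_prodMk_left
  -- Only `nsq u` matters, so `u` is replaced by its squared length `τ`, and then `τ` is shifted to
  -- `ρ = nsq y + τ`.
  have hinner : ∀ y : α → ℂ, ∫⁻ u : β → ℂ, F y (nsq y + nsq u) =
      d * V * ∫⁻ ρ, F y ρ * D (ρ - nsq y) := by
    intro y
    have hm : Measurable fun τ => F y (nsq y + τ) := (hFm' y).comp (measurable_const_add _)
    rw [← lintegral_map (f := fun τ => F y (nsq y + τ)) hm measurable_nsq, map_nsq_volume,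
      lintegral_smul_measure, lintegral_withDensity_eq_lintegral_mul _ hDm hm, smul_eq_mul,
      ← lintegral_sub_right_eq_self _ (nsq y)]
    congr 1
    refine lintegral_congr fun ρ => ?_
    rw [Pi.mul_apply, add_sub_cancel, mul_comm]
  -- For fixed `ρ`, substitute `y = √ρ w`. The Jacobian is `ρ ^ card α`, and `D (ρ (1 - nsq w))`
  -- factors, so `ρ` and `w` separate; the `ρ` integral goes into the constant.
  have hscale : ∀ ρ, ∫⁻ y : α → ℂ, F y ρ * D (ρ - nsq y) = (Set.Ioc 0 1).indicator
      (fun ρ => ENNReal.ofReal (ρ ^ Fintype.card α) * ENNReal.ofReal (ρ ^ (d - 1))) ρ * I := by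
    intro ρ
    by_cases hρ : ρ ∈ Set.Ioc (0 : ℝ) 1
    · rw [Set.indicator_of_mem hρ]
      have hs : 0 < √ρ := Real.sqrt_pos.mpr hρ.1
      let G : (α → ℂ) → ℝ≥0∞ := fun w => f w * D (ρ - ρ * nsq w)
      have hG : Measurable G := hf.mul (hDm.comp
        (measurable_const.sub (measurable_const.mul measurable_nsq)))
      have h1 : ∀ y : α → ℂ, F y ρ * D (ρ - nsq y) = G ((√ρ)⁻¹ • y) := by
        intro y
        simp only [hF, G]
        rw [Set.indicator_of_mem (show ρ ∈ Set.Iic 1 from hρ.2), nsq_smul, inv_pow,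
          Real.sq_sqrt hρ.1.le, mul_inv_cancel_left₀ hρ.1.ne']
      have h2 : ∀ w, G w = ENNReal.ofReal (ρ ^ (d - 1)) * (f w *
          {w : α → ℂ | nsq w < 1}.indicator
            (fun w => ENNReal.ofReal ((1 - nsq w) ^ (d - 1))) w) := by
        intro w
        have h3 : ρ - ρ * nsq w = ρ * (1 - nsq w) := by ring
        simp only [G, hD, h3]
        by_cases hw : nsq w < 1
        · rw [Set.indicator_of_mem (show _ ∈ Set.Ioi (0 : ℝ) from mul_pos hρ.1 (sub_pos.mpr hw)),
            Set.indicator_of_mem (show w ∈ {w : α → ℂ | nsq w < 1} from hw), mul_pow,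
            ENNReal.ofReal_mul (pow_nonneg hρ.1.le _)]
          ring
        · rw [Set.indicator_of_notMem (show w ∉ {w : α → ℂ | nsq w < 1} from hw),
            Set.indicator_of_notMem, mul_zero, mul_zero]
          rw [Set.mem_Ioi, not_lt]
          exact mul_nonpos_of_nonneg_of_nonpos hρ.1.le (by linarith)
      simp only [h1]
      rw [← lintegral_map hG (measurable_const_smul (√ρ)⁻¹),
        Measure.map_addHaar_smul _ (inv_ne_zero hs.ne'), lintegral_smul_measure, smul_eq_mul]
      simp only [h2]
      rw [lintegral_const_mul' _ _ ENNReal.ofReal_ne_top, ← mul_assoc]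
      congr 3
      rw [Module.finrank_pi_fintype]
      simp only [Complex.finrank_real_complex, Finset.sum_const, Finset.card_univ, smul_eq_mul]
      rw [inv_pow, inv_inv, mul_comm, pow_mul, Real.sq_sqrt hρ.1.le,
        abs_of_nonneg (pow_nonneg hρ.1.le _)]
    · rw [Set.indicator_of_notMem hρ, zero_mul]
      refine lintegral_eq_zero_of_ae_eq_zero (Filter.Eventually.of_forall fun y => ?_)
      rw [Set.mem_Ioc, not_and_or, not_lt, not_le] at hρ
      rcases hρ with h | h
      · simp only [hD]
        rw [Set.indicator_of_notMem, mul_zero]; rfl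
        rw [Set.mem_Ioi, not_lt]
        linarith [nsq_nonneg y]
      · simp only [hF]
        rw [Set.indicator_of_notMem, zero_mul]; rfl
        rwa [Set.mem_Iic, not_le]
  have hjm : Measurable (Function.uncurry fun (y : α → ℂ) ρ => F y ρ * D (ρ - nsq y)) :=
    hFm.mul (hDm.comp (measurable_snd.sub (measurable_nsq.comp measurable_fst)))
  refine (lintegral_congr hinner).trans ?_
  have hjm' : Measurable fun y : α → ℂ => ∫⁻ ρ, F y ρ * D (ρ - nsq y) := hjm.lintegral_prod_right'
  rw [lintegral_const_mul _ hjm', mul_assoc,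
    lintegral_lintegral_swap hjm.aemeasurable]
  simp only [hscale]
  have hEm : Measurable ((Set.Ioc (0 : ℝ) 1).indicator
      (fun ρ => ENNReal.ofReal (ρ ^ Fintype.card α) * ENNReal.ofReal (ρ ^ (d - 1)))) :=
    (by fun_prop : Measurable fun ρ : ℝ => ENNReal.ofReal (ρ ^ Fintype.card α) *
      ENNReal.ofReal (ρ ^ (d - 1))).indicator measurableSet_Ioc
  rw [lintegral_mul_const _ hEm]
  simp only [mul_assoc]

/-- The law of some of the entries of a row of a Haar distributed unitary matrix. -/
theorem lintegral_row_haarU {α β ι : Type} [Fintype α] [Fintype β] [Nonempty β] [Fintype ι]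
    [DecidableEq ι] (e : ι ≃ α ⊕ β) (i₀ : ι) :
    ∃ C : ℝ≥0∞, ∀ f : (α → ℂ) → ℝ≥0∞, Measurable f →
      ∫⁻ k, f (fun a => k.1 i₀ (e.symm (Sum.inl a))) ∂(haarU ι) =
      C * ∫⁻ w : α → ℂ, f w * {w : α → ℂ | nsq w < 1}.indicator
        (fun w => ENNReal.ofReal ((1 - nsq w) ^ (Fintype.card β - 1))) w := by
  obtain ⟨C, hC⟩ := lintegral_normalized_fst α β
  have : Nonempty ι := ⟨i₀⟩
  set V := volume {x : ι → ℂ | nsq x ≤ 1}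
  have hV0 : V ≠ 0 := volume_nsq_le_one_ne_zero
  have hVt : V ≠ ∞ := volume_nsq_le_one_lt_top.ne
  refine ⟨V⁻¹ * C, fun f hf => ?_⟩
  let pr : (ι → ℂ) → α → ℂ := fun x a => x (e.symm (Sum.inl a))
  have hpr : Measurable pr := by fun_prop
  let K : (ι → ℂ) → ℝ≥0∞ := fun x =>
    (Set.Iic (1 : ℝ)).indicator (fun ρ => f ((√ρ)⁻¹ • pr x)) (nsq x)
  have hK : Measurable K := by
    have : K = {x : ι → ℂ | nsq x ≤ 1}.indicator fun x => f ((√(nsq x))⁻¹ • pr x) := rfl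
    rw [this]
    exact (hf.comp ((measurable_nsq.sqrt.inv).smul hpr)).indicator
      (measurableSet_le measurable_nsq measurable_const)
  set σ := ∫⁻ k, f (fun a => k.1 i₀ (e.symm (Sum.inl a))) ∂(haarU ι) with hσ
  -- Lebesgue measure is invariant under `x ↦ x k`, so `K` may be averaged over `k`. For fixed `x ≠
  -- 0`, the vector `x k / |x|` is distributed like a row of a Haar unitary, so the average is `σ`
  -- on the unit ball.
  have h1 : ∫⁻ x, K x = σ * V := by
    have hjc : Continuous fun z : Matrix.unitaryGroup ι ℂ × (ι → ℂ) => z.2 ᵥ* z.1.1 :=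
      Continuous.matrix_vecMul continuous_snd (continuous_subtype_val.comp continuous_fst)
    calc ∫⁻ x, K x = ∫⁻ k, ∫⁻ x, K (x ᵥ* k.1) ∂volume ∂(haarU ι) := by
          have : ∀ k : Matrix.unitaryGroup ι ℂ, ∫⁻ x, K (x ᵥ* k.1) = ∫⁻ x, K x := fun k =>
            (measurePreserving_vecMul_of_mem_unitaryGroup k.2).lintegral_comp hK
          simp only [this, lintegral_const, measure_univ, mul_one]
      _ = ∫⁻ x, ∫⁻ k, K (x ᵥ* k.1) ∂(haarU ι) :=
          lintegral_lintegral_swap (hK.comp hjc.measurable).aemeasurable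
      _ = ∫⁻ x, {x : ι → ℂ | nsq x ≤ 1}.indicator (fun _ => σ) x := by
          refine lintegral_congr_ae ?_
          have h0 : ∀ᵐ x : ι → ℂ, x ≠ 0 := by
            rw [ae_iff]; simp
          filter_upwards [h0] with x hx
          have hpos : 0 < nsq x :=
            lt_of_le_of_ne (nsq_nonneg x) fun h => hx (nsq_eq_zero.mp h.symm)
          by_cases hle : nsq x ≤ 1
          · obtain ⟨u, hu⟩ := exists_unitary_row_eq i₀ (x := (√(nsq x))⁻¹ • x) (by
              rw [nsq_smul, inv_pow, Real.sq_sqrt hpos.le, inv_mul_cancel₀ hpos.ne'])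
            rw [Set.indicator_of_mem (show x ∈ {x : ι → ℂ | nsq x ≤ 1} from hle), hσ,
              ← lintegral_mul_left_eq_self (fun k : Matrix.unitaryGroup ι ℂ =>
                f fun a => k.1 i₀ (e.symm (Sum.inl a))) u]
            refine lintegral_congr fun k => ?_
            simp only [K]
            rw [nsq_vecMul k.2, Set.indicator_of_mem (show nsq x ∈ Set.Iic (1 : ℝ) from hle)]
            congr 1
            funext a
            have h2 : ((√(nsq x))⁻¹ • x) ᵥ* k.1 = Pi.single i₀ 1 ᵥ* (u * k).1 := by
              rw [← hu, Matrix.vecMul_vecMul]; rfl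
            have h3 := congrFun h2 (e.symm (Sum.inl a))
            rw [Matrix.single_one_vecMul] at h3
            refine Eq.trans ?_ h3
            simp only [pr, Pi.smul_apply, Matrix.smul_vecMul]
          · rw [Set.indicator_of_notMem (show x ∉ {x : ι → ℂ | nsq x ≤ 1} from hle)]
            refine (lintegral_congr fun k => ?_).trans lintegral_zero
            simp only [K]
            rw [nsq_vecMul k.2, Set.indicator_of_notMem (show nsq x ∉ Set.Iic (1 : ℝ) from hle)]
      _ = σ * V := by
          rw [lintegral_indicator_const (measurableSet_le measurable_nsq measurable_const)]
  have h2 : ∫⁻ x, K x = C * ∫⁻ w : α → ℂ, f w * {w : α → ℂ | nsq w < 1}.indicator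
        (fun w => ENNReal.ofReal ((1 - nsq w) ^ (Fintype.card β - 1))) w := by
    rw [← hC f hf]
    have hT := (volume_measurePreserving_sumPiEquivProdPi (fun _ : α ⊕ β => ℂ)).comp
      (volume_measurePreserving_piCongrLeft (fun _ : α ⊕ β => ℂ) e)
    let K' : (α → ℂ) × (β → ℂ) → ℝ≥0∞ := fun z =>
      (Set.Iic (1 : ℝ)).indicator (fun ρ => f ((√ρ)⁻¹ • z.1)) (nsq z.1 + nsq z.2)
    have hs : Measurable fun z : (α → ℂ) × (β → ℂ) => nsq z.1 + nsq z.2 :=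
      (measurable_nsq.comp measurable_fst).add (measurable_nsq.comp measurable_snd)
    have hK' : Measurable K' := by
      have : K' = {z : (α → ℂ) × (β → ℂ) | nsq z.1 + nsq z.2 ≤ 1}.indicator
        fun z => f ((√(nsq z.1 + nsq z.2))⁻¹ • z.1) := rfl
      rw [this]
      exact (hf.comp ((hs.sqrt.inv).smul measurable_fst)).indicator
        (measurableSet_le hs measurable_const)
    have h3 := hT.lintegral_comp hK'
    rw [Measure.volume_eq_prod, lintegral_prod _ hK'.aemeasurable] at h3
    refine Eq.trans (lintegral_congr fun x => ?_) h3
    have h4 : ((MeasurableEquiv.sumPiEquivProdPi fun _ : α ⊕ β => ℂ) ∘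
        (MeasurableEquiv.piCongrLeft (fun _ : α ⊕ β => ℂ) e)) x =
        (pr x, fun b => x (e.symm (Sum.inr b))) := by
      refine Prod.ext (funext fun a => ?_) (funext fun b => ?_)
      · exact Equiv.piCongrLeft_apply_eq_cast .. |>.trans (by simp [pr])
      · exact Equiv.piCongrLeft_apply_eq_cast .. |>.trans (by simp)
    rw [h4]
    simp only [K, K']
    congr 1
    rw [nsq, ← e.symm.sum_comp, Fintype.sum_sum_type]
    rfl
  rw [mul_assoc, ← h2, h1, mul_comm σ V, ← mul_assoc, ENNReal.inv_mul_cancel hV0 hVt, one_mul]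

end SphereLaw

/-! ### The square root of `1 - w* w` -/

section RowSqrt

variable {ι : Type*} [Fintype ι] [DecidableEq ι]

/-- The positive square root of `1 - w* w` for a row vector `w` of length at most one. -/
def rowSqrt (w : ι → ℂ) : Matrix ι ι ℂ :=
  1 - (((1 + √(1 - nsq w))⁻¹ : ℝ) : ℂ) • Matrix.vecMulVec (star w) w

theorem rowSqrt_conjTranspose (w : ι → ℂ) : (rowSqrt w)ᴴ = rowSqrt w := by
  rw [rowSqrt, Matrix.conjTranspose_sub, Matrix.conjTranspose_smul, Matrix.conjTranspose_vecMulVec,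
    star_star, Matrix.conjTranspose_one]
  congr 2
  exact Complex.conj_ofReal _

theorem continuous_rowSqrt : Continuous (rowSqrt : (ι → ℂ) → Matrix ι ι ℂ) := by
  have h1 : Continuous fun w : ι → ℂ => (1 + √(1 - nsq w))⁻¹ := by
    refine Continuous.inv₀ ?_ fun w => by positivity
    exact continuous_const.add (continuous_const.sub continuous_nsq).sqrt
  exact continuous_const.sub ((Complex.continuous_ofReal.comp h1).smul
    (continuous_star.matrix_vecMulVec continuous_id))

/-- With `Q = w* w` and `s = √(1 - |w|²)`, squaring gives `(1 - c Q)² = 1 - (2c - c² |w|²) Q`, and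
`c = 1 / (1 + s)` makes the coefficient `1`. This form of `c` also avoids dividing by `|w|²`, so it
is continuous at `w = 0`. -/
theorem rowSqrt_mul_self {w : ι → ℂ} (hw : nsq w ≤ 1) :
    rowSqrt w * rowSqrt w = 1 - Matrix.vecMulVec (star w) w := by
  have hPP : Matrix.vecMulVec (star w) w * Matrix.vecMulVec (star w) w =
      (nsq w : ℂ) • Matrix.vecMulVec (star w) w := by
    rw [Matrix.vecMulVec_mul_vecMulVec, Matrix.vecMulVec_smul, ← ofReal_nsq]
  set s := √(1 - nsq w) with hs
  have hs2 : s ^ 2 = 1 - nsq w := Real.sq_sqrt (by linarith)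
  have hs0 : 0 ≤ s := Real.sqrt_nonneg _
  have hc : (((1 + s)⁻¹ : ℝ) : ℂ) + ((1 + s)⁻¹ : ℝ) - ((1 + s)⁻¹ : ℝ) * ((1 + s)⁻¹ : ℝ) * nsq w
      = 1 := by
    have : (1 + s)⁻¹ + (1 + s)⁻¹ - (1 + s)⁻¹ * (1 + s)⁻¹ * nsq w = 1 := by
      have : 1 + s ≠ 0 := by positivity
      rw [show nsq w = 1 - s ^ 2 by linarith]
      field_simp
      ring
    exact_mod_cast this
  rw [rowSqrt, ← hs]
  simp only [Matrix.mul_sub, Matrix.sub_mul, Matrix.one_mul, Matrix.mul_one, Matrix.smul_mul,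
    Matrix.mul_smul, hPP, smul_smul]
  generalize (((1 + s)⁻¹ : ℝ) : ℂ) = c at hc ⊢
  generalize Matrix.vecMulVec (star w) w = Q
  ext i j
  simp only [Matrix.sub_apply, Matrix.smul_apply, smul_eq_mul]
  linear_combination (-Q i j) * hc

theorem det_rowSqrt {w : ι → ℂ} (hw : nsq w ≤ 1) : (rowSqrt w).det = √(1 - nsq w) := by
  set s := √(1 - nsq w) with hs
  have hs2 : s ^ 2 = 1 - nsq w := Real.sq_sqrt (by linarith)
  have hs0 : 0 ≤ s := Real.sqrt_nonneg _
  have : rowSqrt w = 1 + Matrix.replicateCol Unit (-(((1 + s)⁻¹ : ℝ) : ℂ) • star w) *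
      Matrix.replicateRow Unit w := by
    rw [rowSqrt, ← hs]
    ext i j
    simp [Matrix.vecMulVec_apply, Matrix.mul_apply, sub_eq_add_neg, mul_assoc]
  rw [this, Matrix.det_one_add_replicateCol_mul_replicateRow, dotProduct_smul, ← ofReal_nsq,
    smul_eq_mul]
  have : 1 + -(1 + s)⁻¹ * nsq w = s := by
    have : 1 + s ≠ 0 := by positivity
    rw [show nsq w = 1 - s ^ 2 by linarith]
    field_simp
    ring
  exact_mod_cast this

/-- Testing against the vector `star w` gives `|w|² - |w|⁴ ≥ 0`. -/
theorem nsq_le_one_of_posSemidef {w : ι → ℂ} (h : (1 - Matrix.vecMulVec (star w) w).PosSemidef) :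
    nsq w ≤ 1 := by
  have h1 := (Matrix.posSemidef_iff_dotProduct_mulVec.mp h).2 (star w)
  rw [Matrix.sub_mulVec, Matrix.one_mulVec, Matrix.vecMulVec_mulVec, dotProduct_sub, star_star] at h1
  have h2 : (0 : ℂ) ≤ ((nsq w - nsq w * nsq w : ℝ) : ℂ) := by
    refine h1.trans_eq ?_
    rw [← ofReal_nsq]
    push_cast
    simp [dotProduct_smul, ← ofReal_nsq]
  rw [Complex.zero_le_real] at h2
  nlinarith [nsq_nonneg w]

end RowSqrt

/-! ### The matrix ball density and its first row -/

section BallDensity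

variable {m : Type*} [DecidableEq m]

theorem one_sub_gram_cons {n : ℕ} (w : m → ℂ) (W : Fin n → m → ℂ) :
    1 - (Matrix.of (Fin.cons w W : Fin (n + 1) → m → ℂ))ᴴ * Matrix.of (Fin.cons w W) =
      1 - Matrix.vecMulVec (star w) w - (Matrix.of W)ᴴ * Matrix.of W := by
  ext i j
  simp [Matrix.mul_apply, Fin.sum_univ_succ, Matrix.vecMulVec_apply, sub_sub]

variable [Fintype m]

/-- The density `Δ(1 - W* W)^N` on the matrix ball, extended by zero. -/
def ballDensity {α : Type*} [Fintype α] (N : ℕ) (W : α → m → ℂ) : ℝ≥0∞ :=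
  {W : α → m → ℂ | IsContraction (Matrix.of W)}.indicator
    (fun W => ENNReal.ofReal ((1 - (Matrix.of W)ᴴ * Matrix.of W).det.re ^ N)) W

theorem measurable_ballDensity {α : Type*} [Fintype α] (N : ℕ) :
    Measurable (ballDensity N : (α → m → ℂ) → ℝ≥0∞) := by
  refine Measurable.indicator ?_ ?_
  · refine Continuous.measurable ?_
    refine ENNReal.continuous_ofReal.comp ((Complex.continuous_re.comp ?_).pow N)
    have h : Continuous fun W : α → m → ℂ => (Matrix.of W : Matrix α m ℂ) := continuous_id
    exact (continuous_const.sub (h.matrix_conjTranspose.matrix_mul h)).matrix_det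
  · have h : IsClosed {W : α → m → ℂ | IsContraction (Matrix.of W)} :=
      isClosed_setOf_isContraction (ι := α) (κ := m)
    exact h.measurableSet

/-- With `A = rowSqrt w`, subtracting the Gram matrix of the enlarged matrix from `1` leaves `A² - A
Wᴴ W A = A (1 - Wᴴ W) A`. Since `A` is invertible for `|w| < 1`, positivity is unaffected, and the
determinant gains the factor `(det A)² = 1 - |w|²`. -/
theorem ballDensity_cons_of_lt {n : ℕ} (N : ℕ) {w : m → ℂ} (hw : nsq w < 1)
    (W : Fin n → m → ℂ) :
    ballDensity N (Fin.cons w (fun i => W i ᵥ* rowSqrt w) : Fin (n + 1) → m → ℂ) =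
      ENNReal.ofReal ((1 - nsq w) ^ N) * ballDensity N W := by
  set A := rowSqrt w with hA
  set s := √(1 - nsq w) with hs
  have hs2 : s ^ 2 = 1 - nsq w := Real.sq_sqrt (by linarith)
  have hs0 : 0 < s := Real.sqrt_pos.mpr (by linarith)
  have hdet : A.det = s := det_rowSqrt hw.le
  have hAu : IsUnit A := by
    rw [Matrix.isUnit_iff_isUnit_det, hdet, isUnit_iff_ne_zero]
    exact_mod_cast hs0.ne'
  have key : 1 - (Matrix.of (Fin.cons w (fun i => W i ᵥ* A) : Fin (n + 1) → m → ℂ))ᴴ *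
      Matrix.of (Fin.cons w (fun i => W i ᵥ* A)) =
      star A * (1 - (Matrix.of W)ᴴ * Matrix.of W) * A := by
    have h1 : (Matrix.of (fun i => W i ᵥ* A)) = Matrix.of W * A := rfl
    rw [one_sub_gram_cons, h1, Matrix.conjTranspose_mul, hA, ← rowSqrt_mul_self hw.le,
      Matrix.star_eq_conjTranspose, rowSqrt_conjTranspose]
    simp [Matrix.mul_sub, Matrix.sub_mul, Matrix.mul_assoc]
  have hiff : IsContraction (Matrix.of (Fin.cons w (fun i => W i ᵥ* A) : Fin (n + 1) → m → ℂ)) ↔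
      IsContraction (Matrix.of W) := by
    rw [IsContraction, key, IsContraction, Matrix.IsUnit.posSemidef_star_left_conjugate_iff hAu]
  have hre : (star A * (1 - (Matrix.of W)ᴴ * Matrix.of W) * A).det.re =
      (1 - nsq w) * (1 - (Matrix.of W)ᴴ * Matrix.of W).det.re := by
    rw [Matrix.det_mul, Matrix.det_mul, Matrix.star_eq_conjTranspose, hA, rowSqrt_conjTranspose,
      ← hA, hdet, mul_right_comm, ← Complex.ofReal_mul, Complex.re_ofReal_mul, ← hs2, sq]
  unfold ballDensity
  by_cases hW : IsContraction (Matrix.of W)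
  · rw [Set.indicator_of_mem (show _ ∈ {W | IsContraction (Matrix.of W)} from hiff.mpr hW),
      Set.indicator_of_mem (show _ ∈ {W | IsContraction (Matrix.of W)} from hW), key, hre, mul_pow,
      ENNReal.ofReal_mul (pow_nonneg (by linarith) _)]
  · rw [Set.indicator_of_notMem (show _ ∉ {W | IsContraction (Matrix.of W)} from
        fun h => hW (hiff.mp h)),
      Set.indicator_of_notMem (show _ ∉ {W | IsContraction (Matrix.of W)} from hW), mul_zero]

theorem ballDensity_cons_of_gt {n : ℕ} (N : ℕ) {w : m → ℂ} (hw : 1 < nsq w)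
    (W : Fin n → m → ℂ) : ballDensity N (Fin.cons w W : Fin (n + 1) → m → ℂ) = 0 := by
  refine Set.indicator_of_notMem (fun h => ?_) _
  have h1 : IsContraction (Matrix.of (Fin.cons w W : Fin (n + 1) → m → ℂ)) := h
  rw [IsContraction, one_sub_gram_cons] at h1
  have h2 := h1.add (Matrix.posSemidef_conjTranspose_mul_self (Matrix.of W))
  rw [sub_add_cancel] at h2
  exact absurd (nsq_le_one_of_posSemidef h2) (not_le.mpr hw)

end BallDensity

/-! ### The law of a corner of a Haar unitary, by induction on rows -/

section CornerLaw

/-- The block matrix `diag(1, k)`. -/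
def oneConsMatrix {P : ℕ} (k : Matrix (Fin P) (Fin P) ℂ) : Matrix (Fin (P + 1)) (Fin (P + 1)) ℂ :=
  Matrix.of (Fin.cons (Pi.single 0 1) fun i => Fin.cons 0 (k i))

theorem oneConsMatrix_mul_apply_zero {P : ℕ} {κ : Type*} (k : Matrix (Fin P) (Fin P) ℂ)
    (M : Matrix (Fin (P + 1)) κ ℂ) (j : κ) : (oneConsMatrix k * M) 0 j = M 0 j := by
  simp [oneConsMatrix, Matrix.mul_apply, Pi.single_apply]

theorem oneConsMatrix_mul_apply_succ {P : ℕ} {κ : Type*} (k : Matrix (Fin P) (Fin P) ℂ)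
    (M : Matrix (Fin (P + 1)) κ ℂ) (i : Fin P) (j : κ) :
    (oneConsMatrix k * M) i.succ j = (k * M.submatrix Fin.succ id) i j := by
  simp [oneConsMatrix, Matrix.mul_apply, Fin.sum_univ_succ]

theorem oneConsMatrix_mem_unitaryGroup {P : ℕ} {k : Matrix (Fin P) (Fin P) ℂ}
    (hk : k ∈ Matrix.unitaryGroup (Fin P) ℂ) :
    oneConsMatrix k ∈ Matrix.unitaryGroup (Fin (P + 1)) ℂ := by
  rw [Matrix.mem_unitaryGroup_iff, Matrix.star_eq_conjTranspose]
  ext i j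
  refine Fin.cases ?_ (fun i => ?_) i
  · rw [oneConsMatrix_mul_apply_zero]
    refine Fin.cases ?_ (fun j => ?_) j <;>
      simp [oneConsMatrix, (Fin.succ_ne_zero _).symm]
  · rw [oneConsMatrix_mul_apply_succ]
    refine Fin.cases ?_ (fun j => ?_) j
    · simp [oneConsMatrix, Matrix.mul_apply]
    · have h := congrFun (congrFun (Matrix.mem_unitaryGroup_iff.mp hk) i) j
      rw [Matrix.star_eq_conjTranspose] at h
      have h2 : ((oneConsMatrix k)ᴴ.submatrix Fin.succ id : Matrix _ _ ℂ).col j.succ = kᴴ.col j := by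
        funext a
        simp [oneConsMatrix]
      have h3 : (k * (oneConsMatrix k)ᴴ.submatrix Fin.succ id) i j.succ = (k * kᴴ) i j := by
        rw [Matrix.mul_apply, Matrix.mul_apply]
        exact Finset.sum_congr rfl fun a _ => congrArg _ (congrFun h2 a)
      rw [h3, h, Matrix.one_apply, Matrix.one_apply]
      simp

theorem continuous_oneConsMatrix {P : ℕ} :
    Continuous (oneConsMatrix : Matrix (Fin P) (Fin P) ℂ → _) := by
  refine continuous_matrix fun i j => ?_
  refine Fin.cases ?_ (fun i => ?_) i
  · exact continuous_const
  · refine Fin.cases ?_ (fun j => ?_) j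
    · exact continuous_const
    · simpa [oneConsMatrix] using continuous_id.matrix_elem i j

/-- Integration of a function of matrices with `n + 1` rows against the density of the matrix
ball, splitting off the first row. -/
theorem lintegral_ballDensity_succ {m n N : ℕ} [NeZero m]
    {f : (Fin (n + 1) → Fin m → ℂ) → ℝ≥0∞} (hf : Measurable f) :
    ∫⁻ W, f W * ballDensity N W =
      ∫⁻ w : Fin m → ℂ, (∫⁻ W : Fin n → Fin m → ℂ,
        f (Fin.cons w fun i => W i ᵥ* rowSqrt w) * ballDensity N W) *
        {w : Fin m → ℂ | nsq w < 1}.indicator (fun w => ENNReal.ofReal ((1 - nsq w) ^ (n + N))) w := by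
  have hme := (volume_preserving_piFinSuccAbove (fun _ : Fin (n + 1) => Fin m → ℂ) 0).symm
  have hg : Measurable fun W => f W * ballDensity N W := hf.mul (measurable_ballDensity N)
  have h1 := hme.lintegral_comp hg
  have hcons : ∀ z : (Fin m → ℂ) × (Fin n → Fin m → ℂ),
      (MeasurableEquiv.piFinSuccAbove (fun _ : Fin (n + 1) => Fin m → ℂ) 0).symm z =
        Fin.cons z.1 z.2 := by
    intro z
    exact Fin.insertNth_zero' z.1 z.2
  have hgm := hg.comp hme.measurable
  simp only [Function.comp_def, hcons] at h1 hgm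
  rw [← h1, Measure.volume_eq_prod, lintegral_prod _ hgm.aemeasurable]
  refine lintegral_congr_ae ?_
  have h0 : ∀ᵐ w : Fin m → ℂ, nsq w ≠ 1 := by
    rw [ae_iff]
    simpa using volume_nsq_eq (Fin m) 1
  filter_upwards [h0] with w hw
  rcases lt_or_gt_of_ne hw with hlt | hgt
  · rw [Set.indicator_of_mem (show w ∈ {w : Fin m → ℂ | nsq w < 1} from hlt)]
    set r := 1 - nsq w with hr
    have hr0 : 0 < r := by linarith
    have hdet : ‖(rowSqrt w).det‖ ^ 2 = r := by
      rw [det_rowSqrt hlt.le, Complex.norm_of_nonneg (Real.sqrt_nonneg _), Real.sq_sqrt hr0.le]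
    have hd0 : (rowSqrt w).det ≠ 0 := by
      intro h; rw [h] at hdet; simp at hdet; linarith
    have hgw : Measurable fun W : Fin n → Fin m → ℂ =>
        f (Fin.cons w W) * ballDensity N (Fin.cons w W : Fin (n + 1) → Fin m → ℂ) :=
      hgm.comp measurable_prodMk_left
    have hAm : Measurable fun (W : Fin n → Fin m → ℂ) i => W i ᵥ* rowSqrt w := by
      refine Continuous.measurable (continuous_pi fun i => ?_)
      exact Continuous.matrix_vecMul (continuous_apply i) continuous_const
    -- Substituting `W ↦ W A` in the `n` remaining rows contributes `r ^ n`, one factor `|det A|² =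
    -- r` per row. With `r ^ N` from the density this gives the exponent `n + N`.
    have h2 := lintegral_map (μ := volume) hgw hAm
    rw [map_rows_vecMul_volume hd0, hdet, lintegral_smul_measure, smul_eq_mul,
      Fintype.card_fin] at h2
    simp only [ballDensity_cons_of_lt N hlt, ← hr] at h2
    have h3 : ENNReal.ofReal (r ^ n) * ENNReal.ofReal r⁻¹ ^ n = 1 := by
      rw [← ENNReal.ofReal_pow (by positivity), ← ENNReal.ofReal_mul (by positivity), ← mul_pow,
        mul_inv_cancel₀ hr0.ne', one_pow, ENNReal.ofReal_one]
    have h4 := congrArg (fun t => ENNReal.ofReal (r ^ n) * t) h2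
    simp only [← mul_assoc, h3, one_mul] at h4
    refine h4.trans ?_
    have h5 : ∀ W : Fin n → Fin m → ℂ, f (Fin.cons w fun i => W i ᵥ* rowSqrt w) *
        ENNReal.ofReal (r ^ N) * ballDensity N W = ENNReal.ofReal (r ^ N) *
        (f (Fin.cons w fun i => W i ᵥ* rowSqrt w) * ballDensity N W) := fun W => by ring
    simp only [h5]
    rw [lintegral_const_mul' _ _ ENNReal.ofReal_ne_top, pow_add,
      ENNReal.ofReal_mul (by positivity)]
    ring
  · rw [Set.indicator_of_notMem (show w ∉ {w : Fin m → ℂ | nsq w < 1} from not_lt.mpr hgt.le),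
      mul_zero]
    simp only [ballDensity_cons_of_gt N hgt, mul_zero, lintegral_zero]

/-- The law of a corner of a Haar distributed unitary matrix. -/
theorem lintegral_corner_haarU (m : ℕ) [NeZero m] (n : ℕ) : ∀ (P : ℕ) (h : n + m ≤ P),
    ∃ C : ℝ≥0∞, ∀ f : (Fin n → Fin m → ℂ) → ℝ≥0∞, Measurable f →
      ∫⁻ k, f (fun i j => k.1 (Fin.castLE (by omega) i) (Fin.castLE (by omega) j))
        ∂(haarU (Fin P)) = C * ∫⁻ W, f W * ballDensity (P - m - n) W := by
  induction n with
  | zero =>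
    intro P h
    refine ⟨1, fun f hf => ?_⟩
    have h1 : ∀ W : Fin 0 → Fin m → ℂ, f W * ballDensity (P - m - 0) W = f W := by
      intro W
      have : (Matrix.of W)ᴴ * Matrix.of W = 0 := by ext; simp [Matrix.mul_apply]
      rw [ballDensity, Set.indicator_of_mem]
      · simp [this]
      · change (1 - (Matrix.of W)ᴴ * Matrix.of W).PosSemidef
        rw [this, sub_zero]
        exact Matrix.PosSemidef.one
    simp only [h1, one_mul]
    have h2 : ∀ W : Fin 0 → Fin m → ℂ, f W = f 0 := fun W => by rw [Subsingleton.elim W 0]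
    simp only [h2, lintegral_const, measure_univ, mul_one]
    have h3 : (volume : Measure (Fin 0 → Fin m → ℂ)) Set.univ = 1 := by
      rw [volume_pi, Measure.pi_univ]; simp
    rw [h3, mul_one]
  | succ n ih =>
    intro P' h
    obtain ⟨P, rfl⟩ : ∃ P, P' = P + 1 := ⟨P' - 1, by omega⟩
    obtain ⟨C', hC'⟩ := ih P (by omega)
    have hm : m ≤ P + 1 := by omega
    have hmP : m ≤ P := by omega
    have : Nonempty (Fin (P + 1 - m)) := ⟨⟨0, by omega⟩⟩
    let e : Fin (P + 1) ≃ Fin m ⊕ Fin (P + 1 - m) :=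
      (finSumFinEquiv.trans (finCongr (by omega))).symm
    have he : ∀ a, e.symm (Sum.inl a) = Fin.castLE hm a := fun a => by
      ext; simp [e]
    obtain ⟨C, hC⟩ := lintegral_row_haarU e 0
    refine ⟨C' * C, fun f hf => ?_⟩
    let corner : Matrix (Fin (P + 1)) (Fin (P + 1)) ℂ → Fin (n + 1) → Fin m → ℂ :=
      fun M i j => M (Fin.castLE (by omega) i) (Fin.castLE (by omega) j)
    have hcorner : Continuous corner := continuous_pi fun i => continuous_pi fun j =>
      continuous_id.matrix_elem _ _
    let L : Matrix.unitaryGroup (Fin P) ℂ → Matrix.unitaryGroup (Fin (P + 1)) ℂ :=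
      fun k => ⟨oneConsMatrix k.1, oneConsMatrix_mem_unitaryGroup k.2⟩
    have hL : Continuous L :=
      (continuous_oneConsMatrix.comp continuous_subtype_val).subtype_mk _
    let row : Matrix.unitaryGroup (Fin (P + 1)) ℂ → Fin m → ℂ :=
      fun k j => k.1 0 (Fin.castLE hm j)
    let Ψ : (Fin m → ℂ) → ℝ≥0∞ := fun w => ∫⁻ W : Fin n → Fin m → ℂ,
      f (Fin.cons w fun i => W i ᵥ* rowSqrt w) * ballDensity (P - m - n) W
    have hconsc : Continuous fun z : (Fin m → ℂ) × (Fin n → Fin m → ℂ) =>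
        (Fin.cons z.1 fun i => z.2 i ᵥ* rowSqrt z.1 : Fin (n + 1) → Fin m → ℂ) := by
      refine continuous_pi fun i => ?_
      refine Fin.cases ?_ (fun i => ?_) i
      · exact continuous_fst
      · exact Continuous.matrix_vecMul ((continuous_apply i).comp continuous_snd)
          (continuous_rowSqrt.comp continuous_fst)
    have hΨ : Measurable Ψ := by
      refine Measurable.lintegral_prod_right' (f := fun z : (Fin m → ℂ) × (Fin n → Fin m → ℂ) =>
        f (Fin.cons z.1 fun i => z.2 i ᵥ* rowSqrt z.1) * ballDensity (P - m - n) z.2) ?_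
      exact (hf.comp hconsc.measurable).mul ((measurable_ballDensity _).comp measurable_snd)
    -- Left invariance allows inserting an independent `diag(1, k')`. It keeps the first row `w` and
    -- replaces the block `R` below it, in the first `m` columns, by `k' R`. Since `Rᴴ R = 1 - w*
    -- w`, one has `R = V E A` with `V` unitary, `E` the first `m` standard columns and `A = rowSqrt
    -- w`. Right invariance absorbs `V`, so the induction hypothesis applies to the corner of `k'`.
    have hinner : ∀ k : Matrix.unitaryGroup (Fin (P + 1)) ℂ,
        ∫⁻ k', f (corner (L k' * k).1) ∂(haarU (Fin P)) = C' * Ψ (row k) := by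
      intro k
      set w := row k with hw
      let R : Matrix (Fin P) (Fin m) ℂ := k.1.submatrix Fin.succ (Fin.castLE hm)
      let E : Matrix (Fin P) (Fin m) ℂ :=
        (1 : Matrix (Fin P) (Fin P) ℂ).submatrix id (Fin.castLE hmP)
      have hE : ∀ {r : ℕ} (M : Matrix (Fin r) (Fin P) ℂ), M * E = M.submatrix id (Fin.castLE hmP) := by
        intro r M
        ext i j
        simp [E, Matrix.mul_apply, Matrix.one_apply]
      have hEE : Eᴴ * E = 1 := by
        rw [hE]
        ext i j
        simp [E, Matrix.one_apply, Fin.ext_iff]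
      have hR : Rᴴ * R = 1 - Matrix.vecMulVec (star w) w := by
        ext i j
        have h1 := congrFun (congrFun (Matrix.mem_unitaryGroup_iff'.mp k.2) (Fin.castLE hm i))
          (Fin.castLE hm j)
        rw [Matrix.star_eq_conjTranspose, Matrix.mul_apply, Fin.sum_univ_succ] at h1
        rw [Matrix.sub_apply, eq_sub_iff_add_eq', Matrix.mul_apply, Matrix.vecMulVec_apply]
        refine h1.trans ?_
        simp [Matrix.one_apply]
      have hw1 : nsq w ≤ 1 := by
        refine nsq_le_one_of_posSemidef ?_
        rw [← hR]
        exact Matrix.posSemidef_conjTranspose_mul_self R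
      obtain ⟨V, hV, hRV⟩ := exists_unitary_of_gram_eq (X := E * rowSqrt w) (Y := R) (by
        rw [hR, Matrix.conjTranspose_mul, Matrix.mul_assoc, ← Matrix.mul_assoc Eᴴ, hEE,
          Matrix.one_mul, rowSqrt_conjTranspose, rowSqrt_mul_self hw1])
      let c : Matrix.unitaryGroup (Fin P) ℂ → Fin n → Fin m → ℂ :=
        fun k i j => k.1 (Fin.castLE (by omega) i) (Fin.castLE (by omega) j)
      have h1 : ∀ k', corner (L k' * k).1 =
          Fin.cons w fun i => c (k' * ⟨V, hV⟩) i ᵥ* rowSqrt w := by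
        intro k'
        funext i j
        refine Fin.cases ?_ (fun i => ?_) i
        · exact oneConsMatrix_mul_apply_zero k'.1 k.1 _
        · refine (oneConsMatrix_mul_apply_succ k'.1 k.1 (Fin.castLE (by omega) i) _).trans ?_
          change (k'.1 * R) _ j = (c (k' * ⟨V, hV⟩) i ᵥ* rowSqrt w) j
          rw [hRV, ← Matrix.mul_assoc, ← Matrix.mul_assoc, hE]
          rfl
      simp only [h1]
      rw [lintegral_mul_right_eq_self (fun k' => f (Fin.cons w fun i => c k' i ᵥ* rowSqrt w))]
      refine hC' (fun W => f (Fin.cons w fun i => W i ᵥ* rowSqrt w)) ?_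
      exact hf.comp (hconsc.comp (Continuous.prodMk_right w)).measurable
    calc ∫⁻ k, f (corner k.1) ∂(haarU (Fin (P + 1)))
        = ∫⁻ k', ∫⁻ k, f (corner (L k' * k).1) ∂(haarU (Fin (P + 1))) ∂(haarU (Fin P)) := by
          have : ∀ k', ∫⁻ k, f (corner (L k' * k).1) ∂(haarU (Fin (P + 1))) =
              ∫⁻ k, f (corner k.1) ∂(haarU (Fin (P + 1))) := fun k' =>
            lintegral_mul_left_eq_self (fun k : Matrix.unitaryGroup (Fin (P + 1)) ℂ =>
              f (corner k.1)) (L k')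
          simp only [this, lintegral_const, measure_univ, mul_one]
      _ = ∫⁻ k, ∫⁻ k', f (corner (L k' * k).1) ∂(haarU (Fin P)) ∂(haarU (Fin (P + 1))) := by
          refine lintegral_lintegral_swap (Measurable.aemeasurable (hf.comp ?_))
          refine Continuous.measurable (hcorner.comp (continuous_subtype_val.comp ?_))
          exact (hL.comp continuous_fst).mul continuous_snd
      _ = ∫⁻ k, C' * Ψ (row k) ∂(haarU (Fin (P + 1))) := lintegral_congr hinner
      _ = C' * (C * ∫⁻ w, Ψ w * {w : Fin m → ℂ | nsq w < 1}.indicator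
            (fun w => ENNReal.ofReal ((1 - nsq w) ^ (P - m))) w) := by
          have h1 := hC Ψ hΨ
          simp only [he, Fintype.card_fin] at h1
          have h2 : P + 1 - m - 1 = P - m := by omega
          rw [h2] at h1
          have hrow : Continuous row := continuous_pi fun j =>
            continuous_subtype_val.matrix_elem _ _
          have hΨr : Measurable fun k => Ψ (row k) := hΨ.comp hrow.measurable
          rw [lintegral_const_mul _ hΨr, ← h1]
      _ = C' * C * ∫⁻ W, f W * ballDensity (P + 1 - m - (n + 1)) W := by
          have h3 : P + 1 - m - (n + 1) = P - m - n := by omega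
          -- The exponent `P - m` from the row law is exactly the one produced by splitting off a
          -- row of `ballDensity (P - m - n)`.
          have h4 : n + (P - m - n) = P - m := by omega
          rw [h3, lintegral_ballDensity_succ hf, h4, mul_assoc]

end CornerLaw

/-! ### The last corner of `SU(p)` and invariance under `h(z)` -/

section LastCorner

variable {p q : ℕ}

/-- The identification of `(p - q) + q` indices with `p` indices. -/
def splitLast (hqp : q ≤ p) : Fin (p - q) ⊕ Fin q ≃ Fin p :=
  finSumFinEquiv.trans (finCongr (Nat.sub_add_cancel hqp))

/-- The lower right `q × q` corner of a `p × p` matrix. -/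
def lastCorner (hqp : q ≤ p) (M : Matrix (Fin p) (Fin p) ℂ) : Fin q → Fin q → ℂ :=
  fun i j => M (splitLast hqp (Sum.inr i)) (splitLast hqp (Sum.inr j))

theorem continuous_lastCorner (hqp : q ≤ p) : Continuous (lastCorner hqp) :=
  continuous_pi fun _ => continuous_pi fun _ => continuous_id.matrix_elem _ _

/-- Conjugation by a permutation matrix carries the last corner to the first. In `U(p)` the sign of
the permutation causes no difficulty. -/
theorem lintegral_lastCorner_haarU [NeZero q] (hpq : 2 * q ≤ p) :
    ∃ C : ℝ≥0∞, ∀ f : (Fin q → Fin q → ℂ) → ℝ≥0∞, Measurable f →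
      ∫⁻ k, f (lastCorner (le_of_two_mul_le hpq) k.1) ∂(haarU (Fin p)) =
        C * ∫⁻ W, f W * ballDensity (p - 2 * q) W := by
  obtain ⟨C, hC⟩ := lintegral_corner_haarU q q p (by omega)
  refine ⟨C, fun f hf => ?_⟩
  have hqp := le_of_two_mul_le hpq
  have hsub : p - q - q = p - 2 * q := by omega
  rw [← hsub, ← hC f hf]
  let σ : Fin p ≃ Fin p := ((splitLast hqp).symm.trans (Equiv.sumComm _ _)).trans
    (finSumFinEquiv.trans (finCongr (by omega)))
  have hσ : ∀ i, σ.symm (Fin.castLE hqp i) = splitLast hqp (Sum.inr i) := by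
    intro i
    rw [Equiv.symm_apply_eq]
    ext
    simp [σ]
  let Q : Matrix (Fin p) (Fin p) ℂ := (1 : Matrix (Fin p) (Fin p) ℂ).submatrix σ.symm id
  have hQ : Q ∈ Matrix.unitaryGroup (Fin p) ℂ := by
    rw [Matrix.mem_unitaryGroup_iff, Matrix.star_eq_conjTranspose]
    ext i j
    simp [Q, Matrix.mul_apply, Matrix.one_apply]
  have hQM : ∀ (M : Matrix (Fin p) (Fin p) ℂ) i j, (Q * M * Qᴴ) i j = M (σ.symm i) (σ.symm j) := by
    intro M i j
    simp [Q, Matrix.mul_apply, Matrix.one_apply]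
  let Q' : Matrix.unitaryGroup (Fin p) ℂ := ⟨Q, hQ⟩
  rw [← lintegral_mul_right_eq_self (fun k : Matrix.unitaryGroup (Fin p) ℂ =>
      f fun i j => k.1 (Fin.castLE (by omega) i) (Fin.castLE (by omega) j)) Q'⁻¹,
    ← lintegral_mul_left_eq_self (fun k : Matrix.unitaryGroup (Fin p) ℂ =>
      f fun i j => (k * Q'⁻¹).1 (Fin.castLE (by omega) i) (Fin.castLE (by omega) j)) Q']
  refine lintegral_congr fun k => congrArg f ?_
  funext i j
  refine Eq.trans ?_ (hQM k.1 (Fin.castLE hqp i) (Fin.castLE hqp j)).symm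
  rw [hσ, hσ]
  rfl

/-- The law of a corner of a Haar distributed special unitary matrix. -/
theorem lintegral_lastCorner_haarSU [NeZero q] (hpq : 2 * q ≤ p) :
    ∃ C : ℝ≥0∞, ∀ f : (Fin q → Fin q → ℂ) → ℝ≥0∞, Measurable f →
      ∫⁻ k, f (lastCorner (le_of_two_mul_le hpq) k.1) ∂(haarSU (Fin p)) =
        C * ∫⁻ W, f W * ballDensity (p - 2 * q) W := by
  obtain ⟨C, hC⟩ := lintegral_lastCorner_haarU hpq
  refine ⟨C, fun f hf => ?_⟩
  rw [← hC f hf]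
  have hqp := le_of_two_mul_le hpq
  have hq0 : 0 < q := Nat.pos_of_ne_zero (NeZero.ne q)
  let c := lastCorner hqp
  have hc : Continuous c := continuous_lastCorner hqp
  -- A unitary `u` becomes special after rescaling the column `i₀`, which lies outside the corner
  -- and exists because `q < p`. Averaging over `u` then compares `SU(p)` with `U(p)`.
  have hSU : ∀ u : Matrix.unitaryGroup (Fin p) ℂ,
      ∫⁻ k, f (c (k.1 * u.1)) ∂(haarSU (Fin p)) = ∫⁻ k, f (c k.1) ∂(haarSU (Fin p)) := by
    intro u
    let i₀ : Fin p := splitLast hqp (Sum.inl ⟨0, by omega⟩)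
    have hi₀ : ∀ j, splitLast hqp (Sum.inr j) ≠ i₀ := fun j h =>
      Sum.inr_ne_inl ((splitLast hqp).injective h)
    have hdu := star_det_mul_det_of_mem_unitaryGroup u.2
    let D : Matrix (Fin p) (Fin p) ℂ :=
      Matrix.diagonal fun i => if i = i₀ then star u.1.det else 1
    have hD : D ∈ Matrix.unitaryGroup (Fin p) ℂ := by
      rw [Matrix.mem_unitaryGroup_iff', Matrix.star_eq_conjTranspose,
        Matrix.diagonal_conjTranspose, Matrix.diagonal_mul_diagonal, ← Matrix.diagonal_one]
      congr 1
      funext i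
      by_cases h : i = i₀
      · simp only [Pi.star_apply, h, if_true, star_star]
        rw [mul_comm, hdu]
      · simp [h]
    have huD : u.1 * D ∈ Matrix.specialUnitaryGroup (Fin p) ℂ := by
      rw [Matrix.mem_specialUnitaryGroup_iff]
      refine ⟨mul_mem u.2 hD, ?_⟩
      rw [Matrix.det_mul, Matrix.det_diagonal, Finset.prod_ite_eq' Finset.univ i₀]
      simp only [Finset.mem_univ, if_true]
      rw [mul_comm, hdu]
    rw [← lintegral_mul_right_eq_self (fun k : SU (Fin p) => f (c k.1)) ⟨_, huD⟩]
    refine lintegral_congr fun k => congrArg f ?_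
    have h1 : (k * (⟨_, huD⟩ : SU (Fin p))).1 = k.1 * u.1 * D := (Matrix.mul_assoc _ _ _).symm
    rw [h1]
    funext i j
    simp only [c, lastCorner, D, Matrix.mul_diagonal]
    rw [if_neg (hi₀ j), mul_one]
  have hjc : Continuous fun z : SU (Fin p) × Matrix.unitaryGroup (Fin p) ℂ => c (z.1.1 * z.2.1) :=
    hc.comp ((continuous_subtype_val.comp continuous_fst).mul
      (continuous_subtype_val.comp continuous_snd))
  have hU : ∀ k : SU (Fin p),
      ∫⁻ u, f (c (k.1 * u.1)) ∂(haarU (Fin p)) = ∫⁻ u, f (c u.1) ∂(haarU (Fin p)) := fun k =>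
    lintegral_mul_left_eq_self (fun u : Matrix.unitaryGroup (Fin p) ℂ => f (c u.1))
      ⟨k.1, (Matrix.mem_specialUnitaryGroup_iff.mp k.2).1⟩
  have hswap := lintegral_lintegral_swap (μ := haarSU (Fin p)) (ν := haarU (Fin p))
    (f := fun k u => f (c (k.1 * u.1))) (hf.comp hjc.measurable).aemeasurable
  simp only [hSU, hU, lintegral_const, measure_univ, mul_one] at hswap
  exact hswap.symm

/-- The matrix ball measure `Δ(1 - w* w)^N dw`. -/
def ballMeasure (q N : ℕ) : Measure (Fin q → Fin q → ℂ) := volume.withDensity (ballDensity N)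

theorem map_lastCorner_haarSU [NeZero q] (hpq : 2 * q ≤ p) :
    ∃ C : ℝ≥0∞, Measure.map (fun k : SU (Fin p) => lastCorner (le_of_two_mul_le hpq) k.1)
      (haarSU (Fin p)) = C • ballMeasure q (p - 2 * q) := by
  obtain ⟨C, hC⟩ := lintegral_lastCorner_haarSU hpq
  refine ⟨C, Measure.ext_of_lintegral _ fun f hf => ?_⟩
  have hm : Measurable fun k : SU (Fin p) => lastCorner (le_of_two_mul_le hpq) k.1 :=
    ((continuous_lastCorner _).comp continuous_subtype_val).measurable
  rw [lintegral_map hf hm, hC f hf,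
    lintegral_smul_measure, ballMeasure,
    lintegral_withDensity_eq_lintegral_mul _ (measurable_ballDensity _) hf, smul_eq_mul]
  simp only [Pi.mul_apply, mul_comm]

variable [NeZero q]

/-- Left multiplication by `h(z)`. -/
def hDiagMul (z : Circle) (w : Fin q → Fin q → ℂ) : Fin q → Fin q → ℂ :=
  (hDiag (z : ℂ) * Matrix.of w : Matrix (Fin q) (Fin q) ℂ)

/-- The matrix ball measure is invariant under multiplication by `h(z)`. -/
theorem measurePreserving_hDiag_mul (z : Circle) (N : ℕ) :
    MeasurePreserving (hDiagMul z) (ballMeasure q N) (ballMeasure q N) := by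
  let d : Fin q → ℂ := fun i => if i = 0 then (z : ℂ) else 1
  have hd : ∀ i, star (d i) * d i = 1 := by
    intro i
    by_cases h : i = 0
    · simpa [d, h] using circle_star_mul_self z
    · simp [d, h]
  let T : (Fin q → Fin q → ℂ) → Fin q → Fin q → ℂ := hDiagMul z
  have hTi : ∀ w, T w = fun i => w i ᵥ* Matrix.diagonal (fun _ => d i) := by
    intro w
    funext i j
    change (hDiag (z : ℂ) * Matrix.of w : Matrix (Fin q) (Fin q) ℂ) i j = _
    rw [hDiag, Matrix.diagonal_mul, Matrix.vecMul_diagonal, mul_comm]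
    rfl
  have hT : MeasurePreserving T volume volume := by
    have := volume_preserving_pi (f := fun i (x : Fin q → ℂ) => x ᵥ* Matrix.diagonal (fun _ => d i))
      (fun i => measurePreserving_vecMul_of_mem_unitaryGroup (by
        rw [Matrix.mem_unitaryGroup_iff', Matrix.star_eq_conjTranspose,
          Matrix.diagonal_conjTranspose, Matrix.diagonal_mul_diagonal, ← Matrix.diagonal_one]
        congr 1
        funext _
        exact hd i))
    rw [show T = _ from funext hTi]
    exact this
  have hb : ∀ w, ballDensity N (T w) = ballDensity N w := by
    intro w
    have h1 : (Matrix.of (T w))ᴴ * Matrix.of (T w) = (Matrix.of w)ᴴ * Matrix.of w := by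
      change (hDiag (z : ℂ) * Matrix.of w)ᴴ * (hDiag (z : ℂ) * Matrix.of w) = _
      rw [Matrix.conjTranspose_mul, Matrix.mul_assoc, ← Matrix.mul_assoc (hDiag _)ᴴ,
        hDiag_conjTranspose, hDiag_mul, circle_star_mul_self, hDiag_one, Matrix.one_mul]
    have h2 : IsContraction (Matrix.of (T w)) ↔ IsContraction (Matrix.of w) := by
      rw [IsContraction, h1, IsContraction]
    unfold ballDensity
    by_cases hw : IsContraction (Matrix.of w)
    · rw [Set.indicator_of_mem (show _ ∈ {W | IsContraction (Matrix.of W)} from h2.mpr hw),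
        Set.indicator_of_mem (show _ ∈ {W | IsContraction (Matrix.of W)} from hw), h1]
    · rw [Set.indicator_of_notMem (show _ ∉ {W | IsContraction (Matrix.of W)} from
          fun h => hw (h2.mp h)),
        Set.indicator_of_notMem (show _ ∉ {W | IsContraction (Matrix.of W)} from hw)]
  refine ⟨hT.measurable, Measure.ext_of_lintegral _ fun f hf => ?_⟩
  have hfT : Measurable fun w => f (T w) := hf.comp hT.measurable
  rw [lintegral_map hf hT.measurable, ballMeasure,
    lintegral_withDensity_eq_lintegral_mul _ (measurable_ballDensity _) hf,
    lintegral_withDensity_eq_lintegral_mul _ (measurable_ballDensity _) hfT,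
    ← hT.lintegral_comp ((measurable_ballDensity _).mul hf)]
  refine lintegral_congr fun w => ?_
  rw [Pi.mul_apply, Pi.mul_apply, hb]

theorem hDiag_conj_mem (z : Circle) {v : Matrix (Fin q) (Fin q) ℂ}
    (hv : v ∈ Matrix.specialUnitaryGroup (Fin q) ℂ) :
    hDiag ((z⁻¹ : Circle) : ℂ) * v * hDiag (z : ℂ) ∈ Matrix.specialUnitaryGroup (Fin q) ℂ := by
  rw [Matrix.mem_specialUnitaryGroup_iff] at hv ⊢
  refine ⟨mul_mem (mul_mem (hDiag_mem_unitaryGroup (circle_star_mul_self _)) hv.1)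
    (hDiag_mem_unitaryGroup (circle_star_mul_self _)), ?_⟩
  rw [Matrix.det_mul, Matrix.det_mul, det_hDiag, det_hDiag, hv.2, mul_one, ← Circle.coe_mul]
  simp

theorem hDiag_mul_inv (z : Circle) :
    (hDiag (z : ℂ) : Matrix (Fin q) (Fin q) ℂ) * hDiag ((z⁻¹ : Circle) : ℂ) = 1 := by
  rw [hDiag_mul, ← Circle.coe_mul, mul_inv_cancel, Circle.coe_one, hDiag_one]

/-- Conjugation by `h(z)` on `SU(q)`. -/
def conjSU (z : Circle) : SU (Fin q) →* SU (Fin q) where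
  toFun v := ⟨hDiag ((z⁻¹ : Circle) : ℂ) * v.1 * hDiag (z : ℂ), hDiag_conj_mem z v.2⟩
  map_one' := by
    apply Subtype.ext
    have := hDiag_mul_inv (q := q) z⁻¹
    rw [inv_inv] at this
    simpa using this
  map_mul' v w := by
    apply Subtype.ext
    change _ * (v.1 * w.1) * _ = (_ * v.1 * _) * (_ * w.1 * _)
    simp only [Matrix.mul_assoc]
    rw [← Matrix.mul_assoc (hDiag (z : ℂ)) (hDiag ((z⁻¹ : Circle) : ℂ)), hDiag_mul_inv,
      Matrix.one_mul]

theorem measurePreserving_conjSU (z : Circle) :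
    MeasurePreserving (conjSU z) (haarSU (Fin q)) (haarSU (Fin q)) := by
  refine MonoidHom.measurePreserving ?_ ?_ rfl
  · refine Continuous.subtype_mk ?_ _
    exact (continuous_const.mul continuous_subtype_val).mul continuous_const
  · intro v
    refine ⟨conjSU z⁻¹ v, Subtype.ext ?_⟩
    change hDiag ((z⁻¹ : Circle) : ℂ) * (hDiag (((z⁻¹)⁻¹ : Circle) : ℂ) * v.1 *
      hDiag ((z⁻¹ : Circle) : ℂ)) * hDiag (z : ℂ) = v.1
    have h1 := hDiag_mul_inv (q := q) z⁻¹
    rw [inv_inv] at h1 ⊢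
    simp only [Matrix.mul_assoc]
    rw [h1, Matrix.mul_one, ← Matrix.mul_assoc, h1, Matrix.one_mul]

end LastCorner

/-! ### The product formula -/

section ProductFormula

variable {p q : ℕ}

theorem isCompact_matrixBall : IsCompact (matrixBall q) := by
  have hc : IsClosed (matrixBall q) := isClosed_setOf_isContraction (ι := Fin q) (κ := Fin q)
  refine (isCompact_closedBall (0 : Fin q → Fin q → ℂ) 1).of_isClosed_subset hc fun w hw => ?_
  rw [mem_closedBall_zero_iff, pi_norm_le_iff_of_nonneg zero_le_one]
  intro i
  rw [pi_norm_le_iff_of_nonneg zero_le_one]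
  intro j
  have h1 := Matrix.PosSemidef.diag_nonneg (show (1 - (Matrix.of w)ᴴ * Matrix.of w).PosSemidef from hw)
    (i := j)
  have h2 : (0 : ℂ) ≤ ((1 - ∑ k, ‖w k j‖ ^ 2 : ℝ) : ℂ) := by
    refine h1.trans_eq ?_
    simp [Matrix.mul_apply, Complex.conj_mul']
  rw [Complex.zero_le_real] at h2
  have h3 : ‖w i j‖ ^ 2 ≤ ∑ k, ‖w k j‖ ^ 2 := Finset.single_le_sum (f := fun k => ‖w k j‖ ^ 2)
    (fun _ _ => sq_nonneg _) (Finset.mem_univ i)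
  nlinarith [norm_nonneg (w i j)]

theorem measurableSet_matrixBall : MeasurableSet (matrixBall q) :=
  isCompact_matrixBall.measurableSet

theorem continuous_weight : Continuous (weight p q) := by
  have h : Continuous fun W : Fin q → Fin q → ℂ => (Matrix.of W : Matrix (Fin q) (Fin q) ℂ) :=
    continuous_id
  exact ((continuous_const.sub (h.matrix_conjTranspose.matrix_mul h)).matrix_det).pow _

/-- On the ball the determinant is that of a positive semidefinite matrix, hence real and
nonnegative, so taking its real part loses nothing. -/
theorem ballDensity_toReal {w : Fin q → Fin q → ℂ} (hw : w ∈ matrixBall q) :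
    ((ballDensity (p - 2 * q) w).toReal : ℂ) = weight p q w := by
  have h : (0 : ℂ) ≤ (1 - (Matrix.of w)ᴴ * Matrix.of w).det := Matrix.PosSemidef.det_nonneg hw
  obtain ⟨h1, h2⟩ := Complex.nonneg_iff.mp h
  rw [ballDensity, Set.indicator_of_mem (show w ∈ {w | IsContraction (Matrix.of w)} from hw),
    ENNReal.toReal_ofReal (pow_nonneg h1 _), weight, Complex.ofReal_pow]
  congr 1
  exact Complex.ext rfl (by simpa using h2)

theorem ballMeasure_eq (N : ℕ) :
    ballMeasure q N = (volume.restrict (matrixBall q)).withDensity (ballDensity N) := by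
  have h : ballDensity N = (matrixBall q).indicator (ballDensity N) := by
    funext w
    by_cases hw : w ∈ matrixBall q
    · rw [Set.indicator_of_mem hw]
    · rw [Set.indicator_of_notMem hw]
      exact Set.indicator_of_notMem hw _
  rw [ballMeasure]
  conv_lhs => rw [h]
  rw [withDensity_indicator measurableSet_matrixBall]

theorem integral_ballMeasure (g : (Fin q → Fin q → ℂ) → ℂ) :
    ∫ w, g w ∂(ballMeasure q (p - 2 * q)) = ∫ w in matrixBall q, g w * weight p q w := by
  rw [ballMeasure_eq, integral_withDensity_eq_integral_toReal_smul (measurable_ballDensity _)]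
  · refine setIntegral_congr_fun measurableSet_matrixBall fun w hw => ?_
    simp only [Complex.real_smul]
    rw [ballDensity_toReal hw, mul_comm]
  · refine Filter.Eventually.of_forall fun w => ?_
    unfold ballDensity
    by_cases hw : w ∈ matrixBall q
    · exact (Set.indicator_of_mem hw _).trans_lt ENNReal.ofReal_lt_top
    · exact (Set.indicator_of_notMem hw _).trans_lt ENNReal.zero_lt_top

theorem continuous_mixed (t t' : Fin q → ℝ) :
    Continuous fun x : (Fin q → Fin q → ℂ) × SU (Fin q) => mixed t t' x.1 x.2 := by
  have h : Continuous fun x : (Fin q → Fin q → ℂ) × SU (Fin q) =>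
    (Matrix.of x.1 : Matrix (Fin q) (Fin q) ℂ) := continuous_fst
  exact ((continuous_const.matrix_mul h).matrix_mul continuous_const).add
    ((continuous_const.matrix_mul (continuous_subtype_val.comp continuous_snd)).matrix_mul
      continuous_const)

theorem prod_restrict_matrixBall :
    (volume.restrict (matrixBall q)).prod (haarSU (Fin q)) =
      (volume.prod (haarSU (Fin q))).restrict (matrixBall q ×ˢ Set.univ) := by
  rw [← Measure.prod_restrict, Measure.restrict_univ]

variable [NeZero q]

theorem rep_toBlocks₂₁ (hqp : q ≤ p) (t : Fin q → ℝ) (z : Circle) :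
    (rep hqp t z).1.toBlocks₂₁ = sinD t * (1 : Matrix (Fin p) (Fin p) ℂ).submatrix
      (fun i => splitLast hqp (Sum.inr i)) id := by
  ext i j
  obtain ⟨s | s, rfl⟩ := (splitLast hqp).surjective j
  · simp only [rep, blockEquiv, Matrix.toBlocks₂₁, rotBlock, splitLast, sinD, Matrix.diagonal_mul]
    simp [Matrix.one_apply, Fin.ext_iff]
    exact fun h => absurd h (by omega)
  · simp [rep, blockEquiv, Matrix.toBlocks₂₁, rotBlock, splitLast, sinD, Matrix.diagonal_mul,
      Matrix.one_apply, Matrix.diagonal_apply]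

theorem rep_toBlocks₁₂ (hqp : q ≤ p) (t : Fin q → ℝ) (z : Circle) :
    (rep hqp t z).1.toBlocks₁₂ = (1 : Matrix (Fin p) (Fin p) ℂ).submatrix id
      (fun i => splitLast hqp (Sum.inr i)) * -sinD t := by
  ext i j
  obtain ⟨s | s, rfl⟩ := (splitLast hqp).surjective i
  · simp only [rep, blockEquiv, Matrix.toBlocks₁₂, rotBlock, splitLast, sinD, Matrix.mul_neg,
      Matrix.neg_apply, Matrix.mul_diagonal]
    simp [Matrix.one_apply, Fin.ext_iff]
    exact fun h => absurd h (by omega)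
  · by_cases h : s = j <;>
    simp [rep, blockEquiv, Matrix.toBlocks₁₂, rotBlock, splitLast, sinD, Matrix.mul_diagonal,
      Matrix.one_apply, h]

/-- The off-diagonal blocks of the representatives see only the last `q` of the `p` indices, which
produces `-sin t w sin t'`. The other term is `h(z) cos t k₂ h(z') cos t'`. Diagonal matrices
commute, so `h(z z')` can be pulled out on the left, at the cost of its inverse on `w` and a
conjugation of `k₂` by `h(z')`. -/
theorem toBlocks₂₂_rep_mul_embK_mul_rep (hqp : q ≤ p) (t t' : Fin q → ℝ) (z z' : Circle)
    (k : SU (Fin p) × SU (Fin q)) :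
    (rep hqp t z * embK p q k * rep hqp t' z').1.toBlocks₂₂ =
      hDiag ((z * z' : Circle) : ℂ) *
        mixed t t' (hDiagMul (z * z')⁻¹ (lastCorner hqp k.1.1)) (conjSU z' k.2) := by
  have h1 : (rep hqp t z * embK p q k * rep hqp t' z').1.toBlocks₂₂ =
      (rep hqp t z).1.toBlocks₂₁ * k.1.1 * (rep hqp t' z').1.toBlocks₁₂ +
        (rep hqp t z).1.toBlocks₂₂ * k.2.1 * (rep hqp t' z').1.toBlocks₂₂ := by
    change ((rep hqp t z * embK p q k).1 * (rep hqp t' z').1).toBlocks₂₂ = _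
    rw [mul_embK_val, toBlocks_mul, Matrix.toBlocks_fromBlocks₂₂, Matrix.toBlocks_fromBlocks₂₁,
      Matrix.toBlocks_fromBlocks₂₂]
  have h2 : (1 : Matrix (Fin p) (Fin p) ℂ).submatrix (fun i => splitLast hqp (Sum.inr i)) id *
      (k.1.1 * (1 : Matrix (Fin p) (Fin p) ℂ).submatrix id
      (fun i => splitLast hqp (Sum.inr i))) = Matrix.of (lastCorner hqp k.1.1) := by
    ext i j
    simp [Matrix.mul_apply, Matrix.one_apply, lastCorner]
  rw [h1, rep_toBlocks₂₁, rep_toBlocks₁₂, rep_toBlocks₂₂, rep_toBlocks₂₂, mixed]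
  have h3 : Matrix.of (hDiagMul (z * z')⁻¹ (lastCorner hqp k.1.1)) =
      hDiag (((z * z')⁻¹ : Circle) : ℂ) * Matrix.of (lastCorner hqp k.1.1) := rfl
  have h4 : (conjSU z' k.2).1 = hDiag ((z'⁻¹ : Circle) : ℂ) * k.2.1 * hDiag (z' : ℂ) := rfl
  have hs : sinD t * hDiag (((z * z')⁻¹ : Circle) : ℂ) = hDiag (((z * z')⁻¹ : Circle) : ℂ) * sinD t :=
    (hDiag_comm_diagonal _ _).symm
  have hc : cosD t * hDiag ((z'⁻¹ : Circle) : ℂ) = hDiag ((z'⁻¹ : Circle) : ℂ) * cosD t :=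
    (hDiag_comm_diagonal _ _).symm
  rw [h3, h4, Matrix.mul_add]
  congr 1
  · calc _ = -(sinD t * Matrix.of (lastCorner hqp k.1.1) * sinD t') := by
          rw [← h2]; simp only [Matrix.mul_assoc, Matrix.mul_neg]
      _ = -((hDiag ((z * z' : Circle) : ℂ) * hDiag (((z * z')⁻¹ : Circle) : ℂ)) *
            (sinD t * Matrix.of (lastCorner hqp k.1.1) * sinD t')) := by
          rw [hDiag_mul_inv, Matrix.one_mul]
      _ = _ := by
          simp only [Matrix.neg_mul, Matrix.mul_neg, neg_inj, Matrix.mul_assoc]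
          rw [← Matrix.mul_assoc (sinD t) (hDiag _), hs, Matrix.mul_assoc]
  · have h5 : hDiag ((z * z' : Circle) : ℂ) * hDiag ((z'⁻¹ : Circle) : ℂ) =
        (hDiag (z : ℂ) : Matrix (Fin q) (Fin q) ℂ) := by
      rw [hDiag_mul, ← Circle.coe_mul, mul_inv_cancel_right]
    rw [← h5]
    simp only [Matrix.mul_assoc]
    rw [← Matrix.mul_assoc (cosD t) (hDiag _), hc, Matrix.mul_assoc]

variable {φ : SU (Fin p ⊕ Fin q) → ℂ}

theorem lt_of_two_mul_le (hpq : 2 * q ≤ p) : q < p := by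
  have := Nat.pos_of_ne_zero (NeZero.ne q)
  omega

theorem onCone_prodPoint (hqp : q ≤ p) (t t' : Fin q → ℝ) (z z' : Circle)
    (w : Fin q → Fin q → ℂ) (v : SU (Fin q)) :
    onCone hqp φ (prodPoint t t' z z' w v) =
      onCone hqp φ (matCoord (hDiag ((z * z' : Circle) : ℂ) * mixed t t' w v)) :=
  (matCoord_hDiag_mul (z * z') _ φ hqp).symm

theorem continuousOn_onCone_prodPoint (hφ : IsSpherical p q φ) (hqp : q < p) (t t' : Fin q → ℝ)
    (z z' : Circle) :
    ContinuousOn (fun x : (Fin q → Fin q → ℂ) × SU (Fin q) =>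
      onCone hqp.le φ (prodPoint t t' z z' x.1 x.2)) (matrixBall q ×ˢ Set.univ) := by
  simp only [onCone_prodPoint]
  refine (continuousOn_onCone_matCoord hφ hqp).comp
    (continuous_const.matrix_mul (continuous_mixed t t')).continuousOn fun x hx => ?_
  exact (isContraction_of_mem_unitaryGroup (hDiag_mem_unitaryGroup (circle_star_mul_self _))).mul
    (isContraction_mixed t t' hx.1 x.2)

theorem integrable_onCone_prodPoint_mul_weight (hφ : IsSpherical p q φ) (hqp : q < p)
    (t t' : Fin q → ℝ) (z z' : Circle) :
    Integrable (fun x : (Fin q → Fin q → ℂ) × SU (Fin q) =>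
      onCone hqp.le φ (prodPoint t t' z z' x.1 x.2) * weight p q x.1)
      ((volume.restrict (matrixBall q)).prod (haarSU (Fin q))) := by
  rw [prod_restrict_matrixBall]
  exact ((continuousOn_onCone_prodPoint hφ hqp t t' z z').mul
    (continuous_weight.comp continuous_fst).continuousOn).integrableOn_compact
    (isCompact_matrixBall.prod isCompact_univ)

theorem product_formula (hφ : IsSpherical p q φ) (hpq : 2 * q ≤ p) (t t' : Fin q → ℝ)
    (z z' : Circle) :
    φ (rep (le_of_two_mul_le hpq) t z) * φ (rep (le_of_two_mul_le hpq) t' z') =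
      1 / kappa p q * ∫ w in matrixBall q, ∫ v,
        onCone (le_of_two_mul_le hpq) φ (prodPoint t t' z z' w v) * weight p q w
          ∂(haarSU (Fin q)) := by
  have hqp : q < p := lt_of_two_mul_le hpq
  obtain ⟨C, hC⟩ := map_lastCorner_haarSU hpq
  set G : (Fin q → Fin q → ℂ) × SU (Fin q) → ℂ := fun x =>
    onCone hqp.le φ (prodPoint t t' z z' x.1 x.2) with hG
  have hcm : Measurable fun k : SU (Fin p) => lastCorner hqp.le k.1 :=
    ((continuous_lastCorner _).comp continuous_subtype_val).measurable
  have hfst : MeasurePreserving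
      (fun k : SU (Fin p) => hDiagMul (z * z')⁻¹ (lastCorner hqp.le k.1)) (haarSU (Fin p))
      (C • ballMeasure q (p - 2 * q)) :=
    ((measurePreserving_hDiag_mul (z * z')⁻¹ _).smul_measure C).comp ⟨hcm, hC⟩
  have hsf : IsProbabilityMeasure (C • ballMeasure q (p - 2 * q)) := by
    rw [← hfst.map_eq]
    exact Measure.isProbabilityMeasure_map hfst.measurable.aemeasurable
  have hpair : MeasurePreserving (fun k : SU (Fin p) × SU (Fin q) =>
      (hDiagMul (z * z')⁻¹ (lastCorner hqp.le k.1.1), conjSU z' k.2))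
      ((haarSU (Fin p)).prod (haarSU (Fin q)))
      ((C • ballMeasure q (p - 2 * q)).prod (haarSU (Fin q))) :=
    hfst.prod (measurePreserving_conjSU z')
  have hval : ∀ k : SU (Fin p) × SU (Fin q),
      φ (rep hqp.le t z * embK p q k * rep hqp.le t' z') =
        G (hDiagMul (z * z')⁻¹ (lastCorner hqp.le k.1.1), conjSU z' k.2) := by
    intro k
    rw [hφ.eq_onCone_matCoord hqp, toBlocks₂₂_rep_mul_embK_mul_rep, hG]
    exact (onCone_prodPoint _ _ _ _ _ _ _).symm
  -- `G` is controlled only over the matrix ball, where it is continuous; the ball measure is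
  -- absolutely continuous with respect to Lebesgue measure restricted there.
  have hGm : AEStronglyMeasurable G
      ((C • ballMeasure q (p - 2 * q)).prod (haarSU (Fin q))) := by
    have h1 : AEStronglyMeasurable G ((volume.restrict (matrixBall q)).prod (haarSU (Fin q))) := by
      rw [prod_restrict_matrixBall]
      exact (continuousOn_onCone_prodPoint hφ hqp t t' z z').aestronglyMeasurable
        (measurableSet_matrixBall.prod MeasurableSet.univ)
    refine h1.mono_ac (Measure.AbsolutelyContinuous.prod ?_ Measure.AbsolutelyContinuous.rfl)
    rw [ballMeasure_eq]
    exact (withDensity_absolutelyContinuous _ _).smul_left C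
  have hemb : Continuous (embK p q) := by
    refine Continuous.subtype_mk ?_ _
    exact Continuous.matrix_fromBlocks (continuous_subtype_val.comp continuous_fst)
      continuous_const continuous_const (continuous_subtype_val.comp continuous_snd)
  -- Pulled back to `SU(p) × SU(q)`, `G` becomes a continuous function on a compact group.
  have hint : Integrable G ((C • ballMeasure q (p - 2 * q)).prod (haarSU (Fin q))) := by
    rw [← hpair.map_eq, integrable_map_measure (by rwa [hpair.map_eq]) hpair.measurable.aemeasurable]
    have h1 : Continuous fun k : SU (Fin p) × SU (Fin q) =>
        φ (rep hqp.le t z * embK p q k * rep hqp.le t' z') :=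
      hφ.continuous.comp ((continuous_const.mul hemb).mul continuous_const)
    have h2 : G ∘ (fun k : SU (Fin p) × SU (Fin q) =>
        (hDiagMul (z * z')⁻¹ (lastCorner hqp.le k.1.1), conjSU z' k.2)) =
        fun k => φ (rep hqp.le t z * embK p q k * rep hqp.le t' z') :=
      funext fun k => (hval k).symm
    rw [h2]
    exact h1.integrable_of_hasCompactSupport (HasCompactSupport.of_compactSpace _)
  -- `C • ballMeasure` is the law of a random matrix, so it has mass one. This identifies `C` and
  -- shows that `kappa` is nonzero.
  have hmass : (C.toReal : ℂ) * kappa p q = 1 := by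
    have h1 : ∫ _, (1 : ℂ) ∂(C • ballMeasure q (p - 2 * q)) = 1 := by simp
    rw [integral_smul_measure, integral_ballMeasure] at h1
    simpa [kappa] using h1
  have hk : (1 / kappa p q) = C.toReal := by
    rw [one_div]
    exact (eq_inv_of_mul_eq_one_left hmass).symm
  rw [hφ.mul_eq]
  calc _ = ∫ k : SU (Fin p) × SU (Fin q),
        G (hDiagMul (z * z')⁻¹ (lastCorner hqp.le k.1.1), conjSU z' k.2)
          ∂((haarSU (Fin p)).prod (haarSU (Fin q))) := integral_congr_ae
            (Filter.Eventually.of_forall hval)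
    _ = ∫ x, G x ∂((C • ballMeasure q (p - 2 * q)).prod (haarSU (Fin q))) := by
        rw [← hpair.map_eq, integral_map hpair.measurable.aemeasurable (by rwa [hpair.map_eq])]
    _ = ∫ w, ∫ v, G (w, v) ∂(haarSU (Fin q)) ∂(C • ballMeasure q (p - 2 * q)) :=
        integral_prod _ hint
    _ = _ := by
        rw [integral_smul_measure, integral_ballMeasure, hk, Complex.real_smul]
        congr 2
        funext w
        exact (integral_mul_const _ _).symm

end ProductFormula

end ProductFormula

end

open ProductFormula in
theorem mainTheorem1 (p q : ℕ) [NeZero q] (hpq : 2 * q ≤ p)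
    (φ : SU (Fin p ⊕ Fin q) → ℂ) (hφ : IsSpherical p q φ) :
    (∀ g, coneCoord g ∈ cone q ∧ φ g = onCone (le_of_two_mul_le hpq) φ (coneCoord g)) ∧
    (∀ t ∈ alcove q, ∀ z : Circle,
      onCone (le_of_two_mul_le hpq) φ (bracket (fun i => Real.cos (t i)) z) =
        φ (rep (le_of_two_mul_le hpq) t z)) ∧
    ∀ t ∈ alcove q, ∀ t' ∈ alcove q, ∀ z z' : Circle,
      (∀ w ∈ matrixBall q, ∀ v, prodPoint t t' z z' w v ∈ cone q) ∧
      MeasureTheory.Integrable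
        (fun x : (Fin q → Fin q → ℂ) × SU (Fin q) =>
          onCone (le_of_two_mul_le hpq) φ (prodPoint t t' z z' x.1 x.2) * weight p q x.1)
        ((MeasureTheory.volume.restrict (matrixBall q)).prod (haarSU (Fin q))) ∧
      onCone (le_of_two_mul_le hpq) φ (bracket (fun i => Real.cos (t i)) z) *
          onCone (le_of_two_mul_le hpq) φ (bracket (fun i => Real.cos (t' i)) z') =
        1 / kappa p q * ∫ w in matrixBall q, ∫ v,
          onCone (le_of_two_mul_le hpq) φ (prodPoint t t' z z' w v) * weight p q w ∂(haarSU (Fin q)) := by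
  have hqp : q < p := lt_of_two_mul_le hpq
  refine ⟨fun g => ⟨bracket_sing_mem_cone (isContraction_toBlocks₂₂ g) _,
      hφ.eq_onCone_matCoord hqp g⟩, fun t ht z => onCone_bracket_cos _ φ ht z,
    fun t ht t' ht' z z' => ⟨fun w hw v => bracket_sing_mem_cone (isContraction_mixed t t' hw v) _,
      integrable_onCone_prodPoint_mul_weight hφ hqp t t' z z', ?_⟩⟩
  rw [onCone_bracket_cos _ φ ht, onCone_bracket_cos _ φ ht']
  exact product_formula hφ hpq t t' z z'
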